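/- For an integer $n\ge 0$ let $\omega(n)$ be the number of $(x_1,x_2,x_3,y_1,y_2,y_3)\in\mathbb{Z}^6$ with $$n=x_1^2+x_2^2+x_3^2+3y_1^2+3y_2^2+3y_3^2 .$$ A partition (possibly empty) is a $3$-core if none of the hook numbers of its Young diagram is a multiple of $3$. Let $B_3(n)$ be the number of ordered triples $(\lambda_1,\lambda_2,\lambda_3)$ of partitions, each of them a $3$-core, such that the sum of all the parts of $\lambda_1,\lambda_2,\lambda_3$ is $n$. For $k\ge 1$ let $f_k=\prod_{m\ge 1}(1-q^{km})$, a formal power series in $q$ with rational coefficients. Then $$\omega(6n+5)=4B_3(6n+4)\qquad\text{for all integers } n\ge 0,$$ and $$\sum_{n=0}^{\infty}\omega(6n+5)\,q^n=96\,\frac{f_2^{8}f_3^{3}}{f_1^{5}} .$$ -/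

import Mathlib

open scoped PowerSeries PowerSeries.WithPiTopology

/-- The Young diagram of a partition: its row lengths are the parts in nonincreasing order. -/
def partitionDiagram {n : ℕ} (p : n.Partition) : YoungDiagram :=
  YoungDiagram.ofRowLens (p.parts.sort (· ≥ ·)) (p.parts.pairwise_sort (· ≥ ·)).sortedGE

/-- The hook number of the cell `(i, j)` of a Young diagram: the number of cells of the diagram
strictly to the right in row `i`, plus the number of cells strictly below in column `j`,
plus one. It is used only for cells `(i, j)` of the diagram. -/
def hookNumber (μ : YoungDiagram) (i j : ℕ) : ℕ :=
  (μ.rowLen i - (j + 1)) + (μ.colLen j - (i + 1)) + 1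

/-- A partition is a `t`-core if none of its hook numbers is a multiple of `t`. -/
def IsPartitionCore (t : ℕ) {n : ℕ} (p : n.Partition) : Prop :=
  ∀ i j : ℕ, (i, j) ∈ partitionDiagram p → ¬ t ∣ hookNumber (partitionDiagram p) i j

/-- Partition triples of `n` with `t`-cores: ordered triples of partitions, possibly empty,
all of them `t`-cores, such that the sum of all the parts is `n`.
An element of `Σ m : ℕ, m.Partition` is a partition `⟨m, p⟩` together with its size `m`. -/
def CoreTriple (t n : ℕ) : Type :=
  {T : Fin 3 → (Σ m : ℕ, m.Partition) //
    ∑ i, (T i).1 = n ∧ ∀ i, IsPartitionCore t (T i).2}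

/-- `B₃(n)`, the number of partition triples of `n` with 3-cores. -/
noncomputable def B₃ (n : ℕ) : ℕ := Nat.card (CoreTriple 3 n)

/-- Representations `n = x₁² + x₂² + x₃² + 3 (y₁² + y₂² + y₃²)` with integers `xᵢ`, `yᵢ`. -/
def SenaryRep (n : ℕ) : Type :=
  {v : (Fin 3 → ℤ) × (Fin 3 → ℤ) //
    (∑ i, v.1 i ^ 2) + 3 * (∑ i, v.2 i ^ 2) = (n : ℤ)}

/-- `ω(n)`, the number of these representations. -/
noncomputable def ω (n : ℕ) : ℕ := Nat.card (SenaryRep n)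

/-- The formal power series `f_k = ∏_{m ≥ 1} (1 - q ^ (k m))`, for `k ≥ 1`. -/
noncomputable def fProd (k : ℕ) : ℚ⟦X⟧ := ∏' m : ℕ, (1 - PowerSeries.X ^ (k * (m + 1)))

/-- There are only finitely many partition triples, so that `B₃` counts them. -/
theorem finite_coreTriple (t n : ℕ) : Finite (CoreTriple t n) := by
  have : ∀ T : CoreTriple t n, ∀ i, (T.1 i).1 < n + 1 := fun T i => by
    have h := Finset.single_le_sum (f := fun i => (T.1 i).1) (fun _ _ => Nat.zero_le _)
      (Finset.mem_univ i)
    have := T.2.1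
    omega
  let F : CoreTriple t n → (Fin 3 → Σ m : Fin (n + 1), (m : ℕ).Partition) :=
    fun T i => ⟨⟨(T.1 i).1, this T i⟩, (T.1 i).2⟩
  refine Finite.of_injective F fun S T h => Subtype.ext (funext fun i => ?_)
  have := congrArg (fun z : Σ m : Fin (n + 1), (m : ℕ).Partition =>
    (⟨z.1, z.2⟩ : Σ m : ℕ, m.Partition)) (congrFun h i)
  exact this

/-- There are only finitely many representations, so that `ω` counts them. -/
theorem finite_senaryRep (n : ℕ) : Finite (SenaryRep n) := by
  have key : ∀ a : ℤ, a ^ 2 ≤ n → a ∈ Set.Icc (-n : ℤ) n := fun a ha =>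
    ⟨by nlinarith [Int.le_self_sq (-a)], (Int.le_self_sq a).trans ha⟩
  have hx : ∀ v : SenaryRep n, ∀ i, v.1.1 i ^ 2 ≤ n ∧ v.1.2 i ^ 2 ≤ n := by
    rintro ⟨⟨x, y⟩, h⟩ i
    have h1 := Finset.single_le_sum (f := fun i => x i ^ 2) (fun i _ => sq_nonneg _)
      (Finset.mem_univ i)
    have h2 := Finset.single_le_sum (f := fun i => y i ^ 2) (fun i _ => sq_nonneg _)
      (Finset.mem_univ i)
    have := sq_nonneg (x i)
    have := sq_nonneg (y i)
    dsimp only at *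
    constructor <;> linarith
  let F : SenaryRep n → (Fin 3 → Set.Icc (-n : ℤ) n) × (Fin 3 → Set.Icc (-n : ℤ) n) :=
    fun v => (fun i => ⟨_, key _ (hx v i).1⟩, fun i => ⟨_, key _ (hx v i).2⟩)
  refine Finite.of_injective F fun v w h => Subtype.ext (Prod.ext ?_ ?_)
  · exact funext fun i => congrArg Subtype.val (congrFun (congrArg Prod.fst h) i)
  · exact funext fun i => congrArg Subtype.val (congrFun (congrArg Prod.snd h) i)

/-- The infinite product defining `f_k` converges, in the topology of coefficientwise
convergence. -/
theorem multipliable_fProd {k : ℕ} (hk : 0 < k) :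
    Multipliable fun m : ℕ => (1 : ℚ⟦X⟧) - PowerSeries.X ^ (k * (m + 1)) := by
  simp_rw [sub_eq_add_neg]
  apply PowerSeries.WithPiTopology.multipliable_one_add_of_tendsto_order_atTop_nhds_top
  refine ENat.tendsto_nhds_top_iff_natCast_lt.mpr
    fun n => Filter.eventually_atTop.mpr ⟨n, fun m hm => ?_⟩
  rw [PowerSeries.order_neg, PowerSeries.order_X_pow]
  norm_cast
  nlinarith

/-- `f_k` has constant coefficient `1`, so that it is invertible. -/
theorem constantCoeff_fProd {k : ℕ} (hk : 0 < k) : PowerSeries.constantCoeff (fProd k) = 1 := by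
  rw [fProd, (multipliable_fProd hk).map_tprod _ (PowerSeries.WithPiTopology.continuous_constantCoeff ℚ)]
  simp [hk.ne']

/-! Write a(q) = `eisensteinTheta`, c(q) = `coreTheta`, ψ(q) = `psiTheta`, A(q) = `pentagonalTheta`.
The numbers ω(n) are the coefficients of the cube of `quadTheta`. A 3-core is determined by a point
of ℤ², its size being the value of `coreForm` there (`exists_equiv_threeCore`), so B₃(n) is the
coefficient of qⁿ in c(q)³. Both claims thus concern arithmetic progressions of coefficients of
cubes of theta series.

Splitting lattices into cosets gives quadTheta = a(q⁴) + 2qψ(q²)ψ(q⁶), the corresponding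
2-dissections of a and c, and 3-dissections of a and ψ. With them ∑ ω(6n+5)qⁿ becomes a polynomial
in a(q²), c(q²), A(q), ψ(q), ψ(q³) (`progression_quadTheta_cube`). The same happens to ∑ B₃(6n+4)qⁿ
(`progression_coreTheta_cube`), after c(q)³ is 3-dissected by `coreTheta_cube`.

Both collapse by `core_eisenstein_identity`, c(q²)(a(q²)A(q) + 3q c(q²)ψ(q³)) = A(q)²ψ(q)²ψ(q³): the
first series is 96 A²ψ³ψ(q³) and the second is 24 A²ψ³ψ(q³). Product formulas for A and ψ turn this
into the stated quotient.

The identity rests on two facts. Comparing residues mod 3 in the exponents of f₂³ = φ(-q)ψ(q)² with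
the Borwein series b(q²)f₆, where b(q) = a(q³) - 3q c(q³), gives `cubic_dissection`. Multiplying ψ
over q, εq, ε²q for a primitive cube root of unity ε gives A³ψ(q³) + qψ(q³)⁴ = ψ⁴
(`psiTheta_cubic_identity`). The basic product formulas come from finite q-binomial identities,
passed to the limit modulo powers of q. -/

/-! ### Formal theta series -/

/-- The series `∑ s, c s * q ^ w s`, for a weight `w` with finite fibres. -/
noncomputable def thetaSeries {S : Type*} (c : S → ℂ) (w : S → ℤ) : ℂ⟦X⟧ :=
  PowerSeries.mk fun n => ∑ᶠ (s) (_ : w s = n), c s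

/-- Weights that are nonnegative and have finite sublevel sets. -/
structure Admissible {S : Type*} (w : S → ℤ) : Prop where
  nonneg : ∀ s, 0 ≤ w s
  finite : ∀ n : ℤ, {s | w s ≤ n}.Finite

theorem powerSeries_eq_of_forall_X_pow_dvd {f g : ℂ⟦X⟧} (h : ∀ d : ℕ, PowerSeries.X ^ d ∣ f - g) :
    f = g := by
  ext n
  have := PowerSeries.X_pow_dvd_iff.mp (h (n + 1)) n (Nat.lt_succ_self n)
  rwa [map_sub, sub_eq_zero] at this

theorem coeff_thetaSeries {S : Type*} (c : S → ℂ) {w : S → ℤ} {n : ℕ} {A : Finset S}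
    (hA : ∀ s, w s = n → s ∈ A) :
    PowerSeries.coeff n (thetaSeries c w) = ∑ s ∈ A with w s = n, c s := by
  rw [thetaSeries, PowerSeries.coeff_mk, ← finsum_mem_coe_finset]
  refine finsum_congr fun s => finsum_congr_Prop ?_ fun _ => rfl
  simpa using hA s

/-- Modulo a power of `X` a theta series is a polynomial, summed over any finite set containing all
indices of small weight. Limits are handled in this way throughout. -/
theorem X_pow_dvd_thetaSeries_sub {S : Type*} (c : S → ℂ) {w : S → ℤ} (hw : Admissible w) (d : ℕ)
    {A : Finset S} (hA : ∀ s, w s < d → s ∈ A) :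
    PowerSeries.X ^ d ∣
      thetaSeries c w - ∑ s ∈ A, PowerSeries.C (c s) * PowerSeries.X ^ (w s).toNat := by
  rw [PowerSeries.X_pow_dvd_iff]
  intro m hm
  rw [map_sub, sub_eq_zero, coeff_thetaSeries c (A := A) (fun s hs => hA s (by omega)), map_sum,
    Finset.sum_filter]
  refine Finset.sum_congr rfl fun s _ => ?_
  rw [PowerSeries.coeff_C_mul_X_pow]
  have := hw.nonneg s
  split_ifs <;> first | rfl | omega

theorem Admissible.comp {S T : Type*} {w : S → ℤ} (hw : Admissible w) {f : T → S}
    (hf : Function.Injective f) : Admissible (fun t => w (f t)) :=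
  ⟨fun t => hw.nonneg (f t), fun n => Set.Finite.preimage (f := f) hf.injOn (hw.finite n)⟩

theorem Admissible.add {S T : Type*} {w : S → ℤ} {v : T → ℤ} (hw : Admissible w)
    (hv : Admissible v) : Admissible (fun p : S × T => w p.1 + v p.2) := by
  refine ⟨fun p => add_nonneg (hw.nonneg _) (hv.nonneg _), fun n =>
    ((hw.finite n).prod (hv.finite n)).subset ?_⟩
  rintro ⟨s, t⟩ h
  have h1 := hw.nonneg s
  have h2 := hv.nonneg t
  simp only [Set.mem_ofPred_eq, Set.mem_prod] at h ⊢
  omega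

theorem Admissible.mul {S : Type*} {w : S → ℤ} (hw : Admissible w) {k : ℤ} (hk : 0 < k) :
    Admissible (fun s => k * w s) := by
  refine ⟨fun s => mul_nonneg hk.le (hw.nonneg s), fun n => (hw.finite n).subset fun s h => ?_⟩
  have := hw.nonneg s
  simp only [Set.mem_ofPred_eq] at h ⊢
  nlinarith

theorem admissible_int {w : ℤ → ℤ} (h : ∀ k, |k| ≤ w k) : Admissible w := by
  refine ⟨fun k => (abs_nonneg k).trans (h k), fun n => (Set.finite_Icc (-n) n).subset fun k hk => ?_⟩
  exact abs_le.mp ((h k).trans hk)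

theorem admissible_int_prod {w : ℤ × ℤ → ℤ} (h : ∀ p, |p.1| ≤ w p ∧ |p.2| ≤ w p) :
    Admissible w := by
  refine ⟨fun k => (abs_nonneg _).trans (h k).1, fun n =>
    ((Set.finite_Icc (-n) n).prod (Set.finite_Icc (-n) n)).subset fun k hk => ?_⟩
  exact ⟨abs_le.mp ((h k).1.trans hk), abs_le.mp ((h k).2.trans hk)⟩

/-- Modulo `X ^ d` both factors are finite sums, which multiply termwise. Nonnegativity ensures that
a pair of total weight below `d` has both components of weight below `d`. -/
theorem thetaSeries_mul {S T : Type*} (c : S → ℂ) (e : T → ℂ) {w : S → ℤ} {v : T → ℤ}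
    (hw : Admissible w) (hv : Admissible v) :
    thetaSeries c w * thetaSeries e v =
      thetaSeries (fun p : S × T => c p.1 * e p.2) (fun p => w p.1 + v p.2) := by
  refine powerSeries_eq_of_forall_X_pow_dvd fun d => ?_
  let A := (hw.finite d).toFinset
  let B := (hv.finite d).toFinset
  have hA := X_pow_dvd_thetaSeries_sub c hw d (A := A) (by simp +contextual [A, le_of_lt])
  have hB := X_pow_dvd_thetaSeries_sub e hv d (A := B) (by simp +contextual [B, le_of_lt])
  have hAB := X_pow_dvd_thetaSeries_sub (fun p : S × T => c p.1 * e p.2) (hw.add hv) d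
    (A := A ×ˢ B) (by
      rintro ⟨s, t⟩ h
      have h1 := hw.nonneg s
      have h2 := hv.nonneg t
      simp only [A, B, Finset.mem_product, Set.Finite.mem_toFinset, Set.mem_ofPred_eq] at h ⊢
      omega)
  have key : ∑ p ∈ A ×ˢ B, PowerSeries.C (c p.1 * e p.2) *
        PowerSeries.X ^ (w p.1 + v p.2).toNat =
      (∑ s ∈ A, PowerSeries.C (c s) * (PowerSeries.X : ℂ⟦X⟧) ^ (w s).toNat) *
        ∑ t ∈ B, PowerSeries.C (e t) * PowerSeries.X ^ (v t).toNat := by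
    rw [Finset.sum_mul_sum, Finset.sum_product]
    refine Finset.sum_congr rfl fun s _ => Finset.sum_congr rfl fun t _ => ?_
    rw [Int.toNat_add (hw.nonneg s) (hv.nonneg t), pow_add, map_mul]
    ring
  rw [key] at hAB
  have := dvd_sub (dvd_add (hA.mul_right (thetaSeries e v))
    (hB.mul_left (∑ s ∈ A, PowerSeries.C (c s) * (PowerSeries.X : ℂ⟦X⟧) ^ (w s).toNat))) hAB
  convert this using 1
  ring

theorem thetaSeries_split {ι S T : Type*} [Fintype ι] [DecidableEq ι] (c : S → ℂ) {w : S → ℤ}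
    (hw : Admissible w)
    (cls : S → ι) (p : ι → T → S) (hp : ∀ i, Function.Injective (p i))
    (hcls : ∀ i t, cls (p i t) = i) (hsurj : ∀ s, ∃ t, p (cls s) t = s) :
    thetaSeries c w = ∑ i, thetaSeries (fun t => c (p i t)) (fun t => w (p i t)) := by
  classical
  ext n
  rw [map_sum, coeff_thetaSeries c (A := (hw.finite n).toFinset) (by simp +contextual),
    ← Finset.sum_fiberwise _ cls]
  refine Finset.sum_congr rfl fun i _ => ?_
  rw [coeff_thetaSeries _ (A := ((hw.comp (hp i)).finite n).toFinset)
    (by simp +contextual)]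
  symm
  refine Finset.sum_bij (fun t _ => p i t) ?_ (fun _ _ _ _ h => hp i h) ?_ fun _ _ => rfl
  · intro t ht
    simp_all
  · intro s hs
    obtain ⟨t, ht⟩ := hsurj s
    simp only [Finset.mem_filter, Set.Finite.mem_toFinset, Set.mem_ofPred_eq] at hs
    rw [hs.2] at ht
    subst ht
    exact ⟨t, by simp [hs.1.2], rfl⟩

theorem thetaSeries_congr {S : Type*} {c e : S → ℂ} {w v : S → ℤ} (hc : ∀ s, c s = e s)
    (hw : ∀ s, w s = v s) : thetaSeries c w = thetaSeries e v := by
  rw [funext hc, funext hw]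

theorem thetaSeries_add_const {S : Type*} (c : S → ℂ) {w : S → ℤ} (hw : ∀ s, 0 ≤ w s) (k : ℕ) :
    thetaSeries c (fun s => w s + k) = PowerSeries.X ^ k * thetaSeries c w := by
  ext n
  rw [PowerSeries.coeff_X_pow_mul', thetaSeries, PowerSeries.coeff_mk]
  split_ifs with h
  · rw [thetaSeries, PowerSeries.coeff_mk]
    refine finsum_congr fun s => finsum_congr_Prop ?_ fun _ => rfl
    rw [eq_iff_iff]
    omega
  · have : ∀ s, ¬ (w s + k = n) := fun s => by have := hw s; omega
    simp [this]

theorem thetaSeries_const_mul {S : Type*} (a : ℂ) (c : S → ℂ) (w : S → ℤ) :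
    thetaSeries (fun s => a * c s) w = PowerSeries.C a * thetaSeries c w := by
  ext n
  rw [PowerSeries.coeff_C_mul, thetaSeries, thetaSeries, PowerSeries.coeff_mk, PowerSeries.coeff_mk,
    ← smul_eq_mul, smul_finsum]
  congr 1
  ext s
  rw [smul_finsum]
  rfl

theorem expand_thetaSeries {S : Type*} (c : S → ℂ) (w : S → ℤ) {k : ℕ} (hk : k ≠ 0) :
    PowerSeries.expand k hk (thetaSeries c w) = thetaSeries c (fun s => k * w s) := by
  ext n
  rw [PowerSeries.coeff_expand]
  have hk' : (k : ℤ) ≠ 0 := by exact_mod_cast hk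
  split_ifs with h
  · obtain ⟨m, rfl⟩ := h
    rw [Nat.mul_div_cancel_left _ (Nat.pos_of_ne_zero hk), thetaSeries, thetaSeries,
      PowerSeries.coeff_mk, PowerSeries.coeff_mk]
    refine finsum_congr fun s => finsum_congr_Prop ?_ fun _ => rfl
    rw [eq_iff_iff]
    push_cast
    exact (mul_right_inj' hk').symm
  · rw [thetaSeries, PowerSeries.coeff_mk]
    have : ∀ s, ¬ ((k : ℤ) * w s = n) := fun s hs =>
      h (Int.natCast_dvd_natCast.mp ⟨w s, hs.symm⟩)
    simp [this]

theorem coeff_thetaSeries_one {S : Type*} {w : S → ℤ} (hw : Admissible w) (n : ℕ) :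
    PowerSeries.coeff n (thetaSeries (fun _ => 1) w) = (Nat.card {s // w s = n} : ℂ) := by
  classical
  have hfin : {s | w s = n}.Finite := (hw.finite n).subset fun s hs => le_of_eq hs
  rw [coeff_thetaSeries _ (A := hfin.toFinset) (by simp), Finset.sum_const, nsmul_eq_mul, mul_one]
  congr 1
  change _ = Nat.card {s | w s = n}
  rw [Nat.card_coe_set_eq, Set.ncard_eq_toFinset_card _ hfin]
  congr 1
  ext
  simp

/-- The substitution `q ↦ q ^ k`. -/
noncomputable def dilate (k : ℕ) [NeZero k] : ℂ⟦X⟧ →ₐ[ℂ] ℂ⟦X⟧ :=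
  PowerSeries.expand k (NeZero.ne k)

theorem dilate_X (k : ℕ) [NeZero k] : dilate k PowerSeries.X = PowerSeries.X ^ k :=
  PowerSeries.expand_X k _

theorem dilate_dilate {j k l : ℕ} [NeZero j] [NeZero k] [NeZero l] (h : j * k = l) (f : ℂ⟦X⟧) :
    dilate j (dilate k f) = dilate l f := by
  subst h
  exact (PowerSeries.expand_mul j (NeZero.ne j) k (NeZero.ne k) f).symm

theorem dilate_injective (k : ℕ) [NeZero k] : Function.Injective (dilate k) := by
  intro f g h
  ext n
  have := congrArg (PowerSeries.coeff (n * k)) h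
  simpa [dilate, PowerSeries.coeff_expand, Nat.pos_of_ne_zero (NeZero.ne k)] using this

theorem dilate_thetaSeries (k : ℕ) [NeZero k] {S : Type*} (c : S → ℂ) (w : S → ℤ) :
    dilate k (thetaSeries c w) = thetaSeries c (fun s => k * w s) :=
  expand_thetaSeries c w _

/-! ### Theta series of quadratic forms and their dissections -/

/-- The norm form of the Eisenstein integers. -/
def eisensteinForm (p : ℤ × ℤ) : ℤ := p.1 ^ 2 + p.1 * p.2 + p.2 ^ 2

/-- The form that gives the sizes of 3-cores. -/
def coreForm (p : ℤ × ℤ) : ℤ := 3 * (p.1 ^ 2 + p.1 * p.2 + p.2 ^ 2) + p.1 + 2 * p.2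

/-- The theta series `a(q)` of the Eisenstein integers. -/
noncomputable def eisensteinTheta : ℂ⟦X⟧ := thetaSeries (fun _ => 1) eisensteinForm

/-- The theta series `∑ q ^ coreForm p`. -/
noncomputable def coreTheta : ℂ⟦X⟧ := thetaSeries (fun _ => 1) coreForm

theorem abs_le_eisensteinForm (u v : ℤ) :
    |u| ≤ eisensteinForm (u, v) ∧ |v| ≤ eisensteinForm (u, v) := by
  simp only [eisensteinForm]
  constructor <;> refine abs_le.mpr ⟨?_, ?_⟩
  · rcases lt_trichotomy u 0 with h | h | h <;> nlinarith [sq_nonneg (u + 2 * v)]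
  · rcases lt_trichotomy u 0 with h | h | h <;> nlinarith [sq_nonneg (u + 2 * v)]
  · rcases lt_trichotomy v 0 with h | h | h <;> nlinarith [sq_nonneg (2 * u + v)]
  · rcases lt_trichotomy v 0 with h | h | h <;> nlinarith [sq_nonneg (2 * u + v)]

theorem admissible_eisensteinForm : Admissible eisensteinForm :=
  admissible_int_prod fun p => abs_le_eisensteinForm p.1 p.2

theorem admissible_coreForm : Admissible coreForm := by
  refine admissible_int_prod fun ⟨u, v⟩ => ?_
  have h1 : |u| ≤ eisensteinForm (u, v) := (abs_le_eisensteinForm _ _).1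
  have h2 : |v| ≤ eisensteinForm (u, v) := (abs_le_eisensteinForm _ _).2
  have h3 : |u + v| ≤ eisensteinForm (-v, u + v) := (abs_le_eisensteinForm _ _).2
  simp only [coreForm, eisensteinForm, abs_le] at *
  constructor <;> constructor <;> linarith

/-- Dissection of a theta series along a finite partition of its index set. -/
theorem thetaSeries_dissect {ι S T : Type*} [Fintype ι] [DecidableEq ι] {c : S → ℂ} {w : S → ℤ}
    (hw : Admissible w) (cls : S → ι) (p : ι → T → S) (a : ι → ℂ) (e : ι → ℕ) (c₀ : T → ℂ)
    (w₀ : ι → T → ℤ) (hp : ∀ i, Function.Injective (p i))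
    (hcls : ∀ i t, cls (p i t) = i) (hsurj : ∀ s, ∃ t, p (cls s) t = s)
    (h₀ : ∀ i t, 0 ≤ w₀ i t) (hc : ∀ i t, c (p i t) = a i * c₀ t)
    (hwt : ∀ i t, w (p i t) = w₀ i t + e i) :
    thetaSeries c w =
      ∑ i, PowerSeries.C (a i) * PowerSeries.X ^ e i * thetaSeries c₀ (w₀ i) := by
  rw [thetaSeries_split c hw cls p hp hcls hsurj]
  refine Finset.sum_congr rfl fun i _ => ?_
  rw [thetaSeries_congr (hc i) (hwt i), thetaSeries_add_const _ (h₀ i), thetaSeries_const_mul]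
  ring

/-- The sublattice u ≡ v mod 3 is √-3 times the Eisenstein lattice, so its norms are tripled. The
remaining vectors form six cosets, which automorphisms of the form carry to one another; on each the
norm is 3 `coreForm` + 1. The weight `g = 1` yields the 3-dissection of a(q), and `g n = ε ^ n`
yields b(q). -/
theorem thetaSeries_eisensteinForm_mod_three (g : ℤ → ℂ) (hg : ∀ n k, g (n + 3 * k) = g n) :
    thetaSeries (fun p => g (p.1 - p.2)) eisensteinForm =
      PowerSeries.C (g 0) * dilate 3 eisensteinTheta +
        PowerSeries.C (3 * (g 1 + g 2)) * PowerSeries.X * dilate 3 coreTheta := by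
  have h1 : ∀ n : ℤ, n % 3 = 1 → g n = g 1 := fun n hn => by
    rw [← hg 1 (n / 3)]; congr 1; omega
  have h2 : ∀ n : ℤ, n % 3 = 2 → g n = g 2 := fun n hn => by
    rw [← hg 2 (n / 3)]; congr 1; omega
  have h0 : ∀ n : ℤ, n % 3 = 0 → g n = g 0 := fun n hn => by
    rw [← hg 0 (n / 3)]; congr 1; omega
  rw [thetaSeries_dissect admissible_eisensteinForm
    (fun p : ℤ × ℤ => if p.1 % 3 = p.2 % 3 then (0 : Fin 7) else
      if p.1 % 3 = 0 ∧ p.2 % 3 = 1 then 1 else if p.1 % 3 = 0 then 2 else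
      if p.1 % 3 = 1 ∧ p.2 % 3 = 0 then 3 else if p.1 % 3 = 2 ∧ p.2 % 3 = 0 then 4 else
      if p.1 % 3 = 2 then 5 else 6)
    (fun i t => match i with
      | 0 => (t.1 - t.2, t.1 + 2 * t.2)
      | 1 => (3 * t.1, 3 * t.2 + 1)
      | 2 => (-(3 * t.1), -(3 * t.2 + 1))
      | 3 => (3 * t.2 + 1, 3 * t.1)
      | 4 => (-(3 * t.2 + 1), -(3 * t.1))
      | 5 => (-(3 * t.2 + 1), 3 * t.1 + 3 * t.2 + 1)
      | 6 => (3 * t.2 + 1, -(3 * t.1 + 3 * t.2 + 1)) : Fin 7 → ℤ × ℤ → ℤ × ℤ)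
    (![g 0, g 2, g 1, g 1, g 2, g 1, g 2]) ![0, 1, 1, 1, 1, 1, 1] (fun _ => 1)
    (fun i t => if i = 0 then (3 : ℕ) * eisensteinForm t else (3 : ℕ) * coreForm t)]
  · simp only [dilate_thetaSeries, eisensteinTheta, coreTheta, Fin.sum_univ_seven, map_mul, map_add,
      map_ofNat]
    simp
    ring
  · intro i
    fin_cases i <;> rintro ⟨x, y⟩ ⟨x', y'⟩ h <;> simp only [Prod.mk.injEq] at h ⊢ <;> omega
  · intro i
    fin_cases i <;> rintro ⟨x, y⟩ <;> dsimp only <;> split_ifs <;> first | rfl | omega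
  · rintro ⟨u, v⟩
    dsimp only
    split_ifs
    · exact ⟨((2 * u + v) / 3, (v - u) / 3), by dsimp only; ext <;> dsimp only <;> omega⟩
    · exact ⟨(u / 3, v / 3), by dsimp only; ext <;> dsimp only <;> omega⟩
    · exact ⟨(-u / 3, -v / 3), by dsimp only; ext <;> dsimp only <;> omega⟩
    · exact ⟨(v / 3, u / 3), by dsimp only; ext <;> dsimp only <;> omega⟩
    · exact ⟨(-v / 3, -u / 3), by dsimp only; ext <;> dsimp only <;> omega⟩
    · exact ⟨((u + v) / 3, -u / 3), by dsimp only; ext <;> dsimp only <;> omega⟩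
    · exact ⟨(-(u + v) / 3, u / 3), by dsimp only; ext <;> dsimp only <;> omega⟩
  · intro i t
    have := admissible_eisensteinForm.nonneg t
    have := admissible_coreForm.nonneg t
    split_ifs <;> positivity
  · intro i t
    rw [mul_one]
    fin_cases i
    exacts [h0 _ (by dsimp only; omega), h2 _ (by dsimp only; omega), h1 _ (by dsimp only; omega),
      h1 _ (by dsimp only; omega), h2 _ (by dsimp only; omega), h1 _ (by dsimp only; omega),
      h2 _ (by dsimp only; omega)]
  · intro i t
    fin_cases i <;> simp [eisensteinForm, coreForm] <;> ring

/-- The form `x² + 3y²`. -/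
def quadForm (p : ℤ × ℤ) : ℤ := p.1 ^ 2 + 3 * p.2 ^ 2

/-- The triangular numbers, indexed by all integers. -/
def triangularForm (n : ℤ) : ℤ := 2 * n ^ 2 + n

/-- The generalized pentagonal numbers. -/
def pentagonalForm (n : ℤ) : ℤ := n * (3 * n + 1) / 2

/-- The generalized octagonal numbers. -/
def octagonalForm (n : ℤ) : ℤ := 3 * n ^ 2 + 2 * n

/-- Ramanujan's `ψ(q)`. -/
noncomputable def psiTheta : ℂ⟦X⟧ := thetaSeries (fun _ => 1) triangularForm

/-- Ramanujan's `f(q, q²)`. -/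
noncomputable def pentagonalTheta : ℂ⟦X⟧ := thetaSeries (fun _ => 1) pentagonalForm

/-- Ramanujan's `φ(-q)`. -/
noncomputable def altSquareTheta : ℂ⟦X⟧ := thetaSeries (fun n : ℤ => (-1) ^ n) fun n => n ^ 2

/-- The alternating theta series of the octagonal numbers. -/
noncomputable def altOctagonalTheta : ℂ⟦X⟧ := thetaSeries (fun n : ℤ => (-1) ^ n) octagonalForm

/-- The theta series of the form `x² + 3y²`. -/
noncomputable def quadTheta : ℂ⟦X⟧ := thetaSeries (fun _ => 1) quadForm

theorem two_mul_pentagonalForm (n : ℤ) : 2 * pentagonalForm n = 3 * n ^ 2 + n := by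
  have : 2 ∣ n * (3 * n + 1) := by
    rcases Int.even_or_odd' n with ⟨k, rfl | rfl⟩
    · exact ⟨k * (6 * k + 1), by ring⟩
    · exact ⟨(2 * k + 1) * (3 * k + 2), by ring⟩
  rw [pentagonalForm, Int.mul_ediv_cancel' this]
  ring

theorem admissible_sq : Admissible fun n : ℤ => n ^ 2 :=
  admissible_int fun k => by
    rw [← sq_abs]
    nlinarith [Int.le_self_sq |k|]

theorem admissible_triangularForm : Admissible triangularForm :=
  admissible_int fun k => by
    have := Int.le_self_sq |k|
    rw [sq_abs] at this
    simp only [triangularForm]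
    rcases abs_cases k with h | h <;> linarith

theorem admissible_octagonalForm : Admissible octagonalForm :=
  admissible_int fun k => by
    have := Int.le_self_sq |k|
    rw [sq_abs] at this
    simp only [octagonalForm]
    rcases abs_cases k with h | h <;> linarith

theorem admissible_pentagonalForm : Admissible pentagonalForm :=
  admissible_int fun k => by
    have := Int.le_self_sq |k|
    rw [sq_abs] at this
    have := two_mul_pentagonalForm k
    rcases abs_cases k with h | h <;> linarith

theorem admissible_quadForm : Admissible quadForm := by
  refine admissible_int_prod fun ⟨x, y⟩ => ?_
  have h1 := Int.le_self_sq |x|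
  have h2 := Int.le_self_sq |y|
  simp only [sq_abs, quadForm] at *
  constructor <;> nlinarith [sq_nonneg x, sq_nonneg y]

theorem dilate_mul_dilate (j k : ℕ) [NeZero j] [NeZero k] {S T : Type*} {w : S → ℤ} {v : T → ℤ}
    (hw : Admissible w) (hv : Admissible v) :
    dilate j (thetaSeries (fun _ => 1) w) * dilate k (thetaSeries (fun _ => 1) v) =
      thetaSeries (fun _ => 1) (fun p : S × T => j * w p.1 + k * v p.2) := by
  rw [dilate_thetaSeries, dilate_thetaSeries, thetaSeries_mul _ _
    (hw.mul (by exact_mod_cast Nat.pos_of_ne_zero (NeZero.ne j)))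
    (hv.mul (by exact_mod_cast Nat.pos_of_ne_zero (NeZero.ne k)))]
  simp

/-- Vectors with x + y even form a lattice on which the form is four times the Eisenstein form.
Those with x + y odd come in two families exchanged by sign, and on each the form diagonalizes into
two triangular numbers. -/
theorem quadTheta_dissection :
    quadTheta = dilate 4 eisensteinTheta +
      2 * PowerSeries.X * (dilate 2 psiTheta * dilate 6 psiTheta) := by
  rw [psiTheta, dilate_mul_dilate 2 6 admissible_triangularForm admissible_triangularForm,
    quadTheta, thetaSeries_dissect admissible_quadForm
    (fun p : ℤ × ℤ => if (p.1 + p.2) % 2 = 0 then (0 : Fin 3) else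
      if (p.1 + p.2) % 4 = 3 then 1 else 2)
    (fun i t => match i with
      | 0 => (2 * t.1 + t.2, t.2)
      | 1 => (-(t.1 + 3 * t.2 + 1), t.1 - t.2)
      | 2 => (t.1 + 3 * t.2 + 1, t.2 - t.1) : Fin 3 → ℤ × ℤ → ℤ × ℤ)
    1 ![0, 1, 1] (fun _ => 1)
    (fun i t => if i = 0 then (4 : ℕ) * eisensteinForm t else
      (2 : ℕ) * triangularForm t.1 + (6 : ℕ) * triangularForm t.2)]
  · simp only [dilate_thetaSeries, eisensteinTheta, Fin.sum_univ_three]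
    simp
    ring
  · intro i
    fin_cases i <;> rintro ⟨x, y⟩ ⟨x', y'⟩ h <;> simp only [Prod.mk.injEq] at h ⊢ <;> omega
  · intro i
    fin_cases i <;> rintro ⟨x, y⟩ <;> dsimp only <;> split_ifs <;> first | rfl | omega
  · rintro ⟨u, v⟩
    dsimp only
    split_ifs
    · exact ⟨((u - v) / 2, v), by dsimp only; ext <;> dsimp only; omega⟩
    · exact ⟨(v - (u + v + 1) / 4, -(u + v + 1) / 4), by dsimp only; ext <;> dsimp only <;> omega⟩
    · exact ⟨((u + v - 1) / 4 - v, (u + v - 1) / 4), by dsimp only; ext <;> dsimp only <;> omega⟩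
  · intro i t
    have := admissible_eisensteinForm.nonneg t
    have := admissible_triangularForm.nonneg t.1
    have := admissible_triangularForm.nonneg t.2
    split_ifs <;> positivity
  · simp
  · intro i t
    fin_cases i <;> simp [eisensteinForm, triangularForm, quadForm] <;> ring

/-- Doubled vectors have four times the norm. Each of the three nonzero classes mod 2 splits into
two halves exchanged by sign, and all six halves have the same diagonal form in triangular numbers.
-/
theorem eisensteinTheta_dissection_two :
    eisensteinTheta = dilate 4 eisensteinTheta +
      6 * PowerSeries.X * (dilate 2 psiTheta * dilate 6 psiTheta) := by
  rw [psiTheta, dilate_mul_dilate 2 6 admissible_triangularForm admissible_triangularForm]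
  conv_lhs => rw [eisensteinTheta]
  rw [thetaSeries_dissect admissible_eisensteinForm
    (fun p : ℤ × ℤ => if p.1 % 2 = 0 ∧ p.2 % 2 = 0 then (0 : Fin 7) else
      if p.2 % 2 = 0 then if (p.1 + p.2) % 4 = 3 then 1 else 2 else
      if p.1 % 2 = 0 then if p.2 % 4 = 3 then 3 else 4 else
      if p.1 % 4 = 1 then 5 else 6)
    (fun i t => match i with
      | 0 => (2 * t.1, 2 * t.2)
      | 1 => (-(2 * t.1 + 2 * t.2 + 1), 2 * t.1 - 2 * t.2)
      | 2 => (2 * t.1 + 2 * t.2 + 1, 2 * t.2 - 2 * t.1)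
      | 3 => (2 * t.2 - 2 * t.1, -(4 * t.2 + 1))
      | 4 => (2 * t.1 - 2 * t.2, 4 * t.2 + 1)
      | 5 => (4 * t.2 + 1, -(2 * t.1 + 2 * t.2 + 1))
      | 6 => (-(4 * t.2 + 1), 2 * t.1 + 2 * t.2 + 1) : Fin 7 → ℤ × ℤ → ℤ × ℤ)
    1 ![0, 1, 1, 1, 1, 1, 1] (fun _ => 1)
    (fun i t => if i = 0 then (4 : ℕ) * eisensteinForm t else
      (2 : ℕ) * triangularForm t.1 + (6 : ℕ) * triangularForm t.2)]
  · simp only [dilate_thetaSeries, eisensteinTheta, Fin.sum_univ_seven]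
    simp
    ring
  · intro i
    fin_cases i <;> rintro ⟨x, y⟩ ⟨x', y'⟩ h <;> simp only [Prod.mk.injEq] at h ⊢ <;> omega
  · intro i
    fin_cases i <;> rintro ⟨x, y⟩ <;> dsimp only <;> split_ifs <;> first | rfl | omega
  · rintro ⟨u, v⟩
    dsimp only
    split_ifs
    · exact ⟨(u / 2, v / 2), by dsimp only; ext <;> dsimp only <;> omega⟩
    · exact ⟨(v / 2 - (u + v + 1) / 4, -(u + v + 1) / 4),
        by dsimp only; ext <;> dsimp only <;> omega⟩
    · exact ⟨((u + v - 1) / 4 - v / 2, (u + v - 1) / 4),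
        by dsimp only; ext <;> dsimp only <;> omega⟩
    · exact ⟨(-(v + 1) / 4 - u / 2, -(v + 1) / 4), by dsimp only; ext <;> dsimp only <;> omega⟩
    · exact ⟨((v - 1) / 4 + u / 2, (v - 1) / 4), by dsimp only; ext <;> dsimp only <;> omega⟩
    · exact ⟨(-(v + 1) / 2 - (u - 1) / 4, (u - 1) / 4),
        by dsimp only; ext <;> dsimp only <;> omega⟩
    · exact ⟨((v - 1) / 2 + (u + 1) / 4, -(u + 1) / 4),
        by dsimp only; ext <;> dsimp only <;> omega⟩
  · intro i t
    have := admissible_eisensteinForm.nonneg t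
    have := admissible_triangularForm.nonneg t.1
    have := admissible_triangularForm.nonneg t.2
    split_ifs <;> positivity
  · simp
  · intro i t
    fin_cases i <;> simp [eisensteinForm, triangularForm] <;> ring

/-- Split n mod 3. The classes 0 and 1 give three times the pentagonal numbers of even and of odd
index, while class 2 reproduces the triangular numbers scaled by 9 and shifted by 1. -/
theorem psiTheta_dissection :
    psiTheta = dilate 3 pentagonalTheta + PowerSeries.X * dilate 9 psiTheta := by
  have h1 : pentagonalTheta =
      thetaSeries (fun _ => 1) (fun t : ℤ => 6 * t ^ 2 + t) +
        thetaSeries (fun _ => 1) (fun t : ℤ => 6 * t ^ 2 + 5 * t + 1) := by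
    rw [pentagonalTheta, thetaSeries_dissect admissible_pentagonalForm
      (fun j => if j % 2 = 0 then (0 : Fin 2) else 1)
      (fun i t => if i = 0 then 2 * t else -(2 * t + 1)) 1 0 (fun _ => 1)
      (fun i t => if i = 0 then 6 * t ^ 2 + t else 6 * t ^ 2 + 5 * t + 1)]
    · simp
    · intro i
      fin_cases i <;> intro x y h <;> simp at h <;> omega
    · intro i
      fin_cases i <;> intro x <;> simp
    · intro s
      by_cases h : s % 2 = 0
      · exact ⟨s / 2, by rw [if_pos h, if_pos rfl]; omega⟩
      · exact ⟨-(s + 1) / 2, by rw [if_neg h, if_neg (by decide : ¬ (1 : Fin 2) = 0)]; omega⟩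
    · intro i t
      have := Int.le_self_sq t
      have := Int.le_self_sq (-t)
      split_ifs <;> nlinarith
    · simp
    · intro i t
      have := two_mul_pentagonalForm (if i = 0 then 2 * t else -(2 * t + 1))
      fin_cases i <;> simp at * <;> linarith
  rw [h1, map_add, dilate_thetaSeries, dilate_thetaSeries]
  conv_lhs => rw [psiTheta]
  rw [thetaSeries_dissect admissible_triangularForm
      (fun j => if j % 3 = 0 then (0 : Fin 3) else if j % 3 = 1 then 1 else 2)
      (fun i t => if i = 0 then 3 * t else if i = 1 then 3 * t + 1 else -(3 * t + 1)) 1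
      ![0, 0, 1] (fun _ => 1)
      (fun i t => if i = 0 then (3 : ℕ) * (6 * t ^ 2 + t) else
        if i = 1 then (3 : ℕ) * (6 * t ^ 2 + 5 * t + 1) else (9 : ℕ) * triangularForm t)]
  · rw [psiTheta, dilate_thetaSeries, Fin.sum_univ_three]
    simp
  · intro i
    fin_cases i <;> intro x y h <;> simp at h <;> omega
  · intro i
    fin_cases i <;> intro x <;> simp
  · intro s
    by_cases h : s % 3 = 0
    · exact ⟨s / 3, by rw [if_pos h, if_pos rfl]; omega⟩
    by_cases h' : s % 3 = 1
    · exact ⟨s / 3, by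
        rw [if_neg h, if_pos h', if_neg (by decide : ¬ (1 : Fin 3) = 0), if_pos rfl]; omega⟩
    · exact ⟨-(s + 1) / 3, by
        rw [if_neg h, if_neg h', if_neg (by decide : ¬ (2 : Fin 3) = 0),
          if_neg (by decide : ¬ (2 : Fin 3) = 1)]; omega⟩
  · intro i t
    have := Int.le_self_sq t
    have := Int.le_self_sq (-t)
    have := admissible_triangularForm.nonneg t
    split_ifs
    · push_cast; nlinarith
    · push_cast; nlinarith
    · positivity
  · simp
  · intro i t
    fin_cases i <;> simp [triangularForm] <;> ring

theorem altSquareTheta_dissection :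
    altSquareTheta = dilate 9 altSquareTheta - 2 * PowerSeries.X * dilate 3 altOctagonalTheta := by
  have h3 : ∀ t : ℤ, (-1 : ℂ) ^ (3 * t) = (-1) ^ t := fun t => by
    rw [zpow_mul]; norm_num
  conv_lhs => rw [altSquareTheta]
  rw [thetaSeries_dissect admissible_sq
      (fun j => if j % 3 = 0 then (0 : Fin 3) else if j % 3 = 1 then 1 else 2)
      (fun i t => if i = 0 then 3 * t else if i = 1 then 3 * t + 1 else -(3 * t + 1))
      ![1, -1, -1] ![0, 1, 1] (fun n : ℤ => (-1) ^ n)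
      (fun i t => if i = 0 then (9 : ℕ) * t ^ 2 else (3 : ℕ) * octagonalForm t)]
  · rw [altSquareTheta, altOctagonalTheta, dilate_thetaSeries, dilate_thetaSeries,
      Fin.sum_univ_three]
    simp
    ring
  · intro i
    fin_cases i <;> intro x y h <;> simp at h <;> omega
  · intro i
    fin_cases i <;> intro x <;> simp
  · intro s
    by_cases h : s % 3 = 0
    · exact ⟨s / 3, by rw [if_pos h, if_pos rfl]; omega⟩
    by_cases h' : s % 3 = 1
    · exact ⟨s / 3, by
        rw [if_neg h, if_pos h', if_neg (by decide : ¬ (1 : Fin 3) = 0), if_pos rfl]; omega⟩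
    · exact ⟨-(s + 1) / 3, by
        rw [if_neg h, if_neg h', if_neg (by decide : ¬ (2 : Fin 3) = 0),
          if_neg (by decide : ¬ (2 : Fin 3) = 1)]; omega⟩
  · intro i t
    have := admissible_octagonalForm.nonneg t
    split_ifs <;> positivity
  · intro i t
    have h1 : (-1 : ℂ) ^ (3 * t + 1) = -(-1) ^ t := by
      rw [zpow_add₀ (by norm_num), h3]; simp
    have h2 : (-1 : ℂ) ^ (-(3 * t + 1)) = -(-1) ^ t := by
      rw [← inv_zpow']; norm_num; exact h1
    fin_cases i
    · simpa using h3 t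
    · simpa using h1
    · simpa using h2
  · intro i t
    fin_cases i <;> simp [octagonalForm] <;> ring

/-- The points with u even and v odd give the term q c(q⁴). The rest is not matched with the product
of A(q²) and ψ(q²) by one linear substitution: both index sets are cut into four families with equal
weights. -/
theorem coreTheta_dissection :
    coreTheta = PowerSeries.X * dilate 4 coreTheta +
      dilate 2 pentagonalTheta * dilate 2 psiTheta := by
  have hadm : Admissible fun p : ℤ × ℤ =>
      (2 : ℕ) * pentagonalForm p.1 + (2 : ℕ) * triangularForm p.2 :=
    (admissible_pentagonalForm.mul (by norm_num)).add (admissible_triangularForm.mul (by norm_num))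
  have hnn : ∀ t : ℤ, 0 ≤ 3 * t ^ 2 + t ∧ 0 ≤ 36 * t ^ 2 + 6 * t ∧ 0 ≤ 36 * t ^ 2 + 30 * t + 6 ∧
      0 ≤ 36 * t ^ 2 + 54 * t + 20 := fun t => by
    have := Int.le_self_sq t
    have := Int.le_self_sq (-t)
    have := sq_nonneg (t + 1)
    have := Int.le_self_sq (-(t + 1))
    refine ⟨?_, ?_, ?_, ?_⟩ <;> nlinarith
  -- The common weights of the four families. On the product side they come from the second index
  -- mod 3 and, in its class 2, from the parity of the first index.
  let w₀ : Fin 4 → ℤ × ℤ → ℤ := fun i t => match i with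
    | 0 => 3 * t.1 ^ 2 + t.1 + (36 * t.2 ^ 2 + 6 * t.2)
    | 1 => 3 * t.1 ^ 2 + t.1 + (36 * t.2 ^ 2 + 30 * t.2 + 6)
    | 2 => 3 * (2 * t.1 + 1) ^ 2 + (2 * t.1 + 1) + (36 * t.2 ^ 2 + 54 * t.2 + 20)
    | 3 => 3 * (2 * t.1) ^ 2 + (2 * t.1) + (36 * t.2 ^ 2 + 54 * t.2 + 20)
  have hw₀ : ∀ i t, 0 ≤ w₀ i t := fun i t => by
    have h2 := hnn t.2
    fin_cases i
    exacts [add_nonneg (hnn _).1 h2.2.1, add_nonneg (hnn _).1 h2.2.2.1,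
      add_nonneg (hnn _).1 h2.2.2.2, add_nonneg (hnn _).1 h2.2.2.2]
  rw [psiTheta, pentagonalTheta,
    dilate_mul_dilate 2 2 admissible_pentagonalForm admissible_triangularForm,
    thetaSeries_dissect hadm
    (fun p : ℤ × ℤ => if p.2 % 3 = 0 then (0 : Fin 4) else if p.2 % 3 = 1 then 1 else
      if p.1 % 2 = 1 then 2 else 3)
    (fun i t => match i with
      | 0 => (t.1, 3 * t.2)
      | 1 => (t.1, 3 * t.2 + 1)
      | 2 => (2 * t.1 + 1, 3 * t.2 + 2)
      | 3 => (2 * t.1, 3 * t.2 + 2) : Fin 4 → ℤ × ℤ → ℤ × ℤ)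
    1 0 (fun _ => 1) w₀]
  · conv_lhs => rw [coreTheta]
    rw [thetaSeries_dissect admissible_coreForm
      (fun p : ℤ × ℤ => if p.2 % 4 = 0 then (0 : Fin 5) else if p.2 % 4 = 2 then 1 else
        if p.1 % 4 = 3 then 2 else if p.1 % 4 = 1 then 3 else 4)
      (fun i t => match i with
        | 0 => (t.1 - 2 * t.2, 4 * t.2)
        | 1 => (t.1 + 2 * t.2 + 1, -(4 * t.2 + 2))
        | 2 => (4 * t.2 + 3, -(2 * t.1 + 2 * t.2 + 3))
        | 3 => (-(4 * t.2 + 3), 2 * t.2 + 1 - 2 * t.1)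
        | 4 => (-(2 * t.1), -(2 * t.2 + 1)) : Fin 5 → ℤ × ℤ → ℤ × ℤ)
      1 ![0, 0, 0, 0, 1] (fun _ => 1)
      (fun i => match i with
        | 0 => w₀ 0
        | 1 => w₀ 1
        | 2 => w₀ 2
        | 3 => w₀ 3
        | 4 => fun t => (4 : ℕ) * coreForm t)]
    · simp only [dilate_thetaSeries, coreTheta, Fin.sum_univ_five, Fin.sum_univ_four]
      simp
      ring
    · intro i
      fin_cases i <;> rintro ⟨x, y⟩ ⟨x', y'⟩ h <;> simp only [Prod.mk.injEq] at h ⊢ <;> omega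
    · intro i
      fin_cases i <;> rintro ⟨x, y⟩ <;> dsimp only <;> split_ifs <;> first | rfl | omega
    · rintro ⟨u, v⟩
      dsimp only
      split_ifs
      · exact ⟨(u + v / 2, v / 4), by dsimp only; ext <;> dsimp only <;> omega⟩
      · exact ⟨(u - 1 + (v + 2) / 2, -(v + 2) / 4), by dsimp only; ext <;> dsimp only <;> omega⟩
      · exact ⟨(-(v + 3) / 2 - (u - 3) / 4, (u - 3) / 4),
          by dsimp only; ext <;> dsimp only <;> omega⟩
      · exact ⟨(-(v - 1) / 2 - (u + 3) / 4, -(u + 3) / 4),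
          by dsimp only; ext <;> dsimp only <;> omega⟩
      · exact ⟨(-u / 2, -(v + 1) / 2), by dsimp only; ext <;> dsimp only <;> omega⟩
    · intro i t
      have := admissible_coreForm.nonneg t
      fin_cases i
      exacts [hw₀ 0 t, hw₀ 1 t, hw₀ 2 t, hw₀ 3 t, by positivity]
    · simp
    · intro i t
      fin_cases i <;> simp [coreForm, w₀] <;> ring
  · intro i
    fin_cases i <;> rintro ⟨x, y⟩ ⟨x', y'⟩ h <;> simp only [Prod.mk.injEq] at h ⊢ <;> omega
  · intro i
    fin_cases i <;> rintro ⟨x, y⟩ <;> dsimp only <;> split_ifs <;> first | rfl | omega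
  · rintro ⟨u, v⟩
    dsimp only
    split_ifs
    · exact ⟨(u, v / 3), by dsimp only; ext <;> dsimp only; omega⟩
    · exact ⟨(u, v / 3), by dsimp only; ext <;> dsimp only; omega⟩
    · exact ⟨(u / 2, v / 3), by dsimp only; ext <;> dsimp only <;> omega⟩
    · exact ⟨(u / 2, v / 3), by dsimp only; ext <;> dsimp only <;> omega⟩
  · exact hw₀
  · simp
  · intro i t
    push_cast
    fin_cases i <;> simp [two_mul_pentagonalForm, triangularForm, w₀] <;> ring

/-! ### Gaussian binomials -/

/-- The finite product `∏ (1 - Q ^ (i + 1))` over `i < n`. -/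
def qPochhammer {R : Type*} [CommRing R] (Q : R) (n : ℕ) : R :=
  ∏ i ∈ Finset.range n, (1 - Q ^ (i + 1))

/-- The Gaussian binomial coefficients. -/
def qBinomial {R : Type*} [CommRing R] (Q : R) : ℕ → ℕ → R
  | _, 0 => 1
  | 0, _ + 1 => 0
  | n + 1, k + 1 => qBinomial Q n k + Q ^ (k + 1) * qBinomial Q n (k + 1)

section qBinomial

variable {R : Type*} [CommRing R] (Q : R)

theorem qPochhammer_succ (n : ℕ) : qPochhammer Q (n + 1) = qPochhammer Q n * (1 - Q ^ (n + 1)) :=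
  Finset.prod_range_succ _ _

theorem qBinomial_zero_right (n : ℕ) : qBinomial Q n 0 = 1 := by
  cases n <;> rfl

theorem qBinomial_eq_zero {n k : ℕ} (h : n < k) : qBinomial Q n k = 0 := by
  induction n generalizing k with
  | zero =>
    obtain ⟨k, rfl⟩ := Nat.exists_eq_succ_of_ne_zero (by omega : k ≠ 0)
    rfl
  | succ n ih =>
    obtain ⟨k, rfl⟩ := Nat.exists_eq_succ_of_ne_zero (by omega : k ≠ 0)
    rw [qBinomial, ih (by omega), ih (by omega)]
    ring

theorem qBinomial_self (n : ℕ) : qBinomial Q n n = 1 := by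
  induction n with
  | zero => rfl
  | succ n ih => rw [qBinomial, ih, qBinomial_eq_zero Q (Nat.lt_succ_self n)]; ring

/-- The quotient formula for Gaussian binomials, cleared of denominators so as to hold in any
commutative ring. Both Pascal predecessors enter the double induction. -/
theorem qBinomial_mul (m k : ℕ) :
    qBinomial Q (m + k) k * qPochhammer Q k * qPochhammer Q m = qPochhammer Q (m + k) := by
  induction m generalizing k with
  | zero => simp [qBinomial_self, qPochhammer]
  | succ m ihm =>
    induction k with
    | zero => simp [qBinomial_zero_right, qPochhammer]
    | succ k ihk =>
      have h1 := ihm (k + 1)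
      rw [show m + 1 + (k + 1) = m + k + 1 + 1 by omega, qBinomial]
      rw [show m + 1 + k = m + k + 1 by omega] at ihk
      rw [show m + (k + 1) = m + k + 1 by omega] at h1
      rw [qPochhammer_succ Q (m + k + 1)]
      rw [qPochhammer_succ Q k] at h1 ⊢
      rw [qPochhammer_succ Q m] at ihk ⊢
      linear_combination (1 - Q ^ (k + 1)) * ihk + Q ^ (k + 1) * (1 - Q ^ (m + 1)) * h1

/-- The second variable `x` makes the identity homogeneous; substituting a power of q for it later
replaces the negative powers of q in the triple product. -/
theorem qBinomial_theorem (x y : R) (n : ℕ) :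
    ∏ i ∈ Finset.range n, (x + y * Q ^ i) =
      ∑ k ∈ Finset.range (n + 1), qBinomial Q n k * Q ^ k.choose 2 * y ^ k * x ^ (n - k) := by
  induction n generalizing y with
  | zero => simp [qBinomial]
  | succ n ih =>
    rw [Finset.prod_range_succ', Finset.sum_range_succ']
    have h : ∏ i ∈ Finset.range n, (x + y * Q ^ (i + 1)) =
        ∏ i ∈ Finset.range n, (x + y * Q * Q ^ i) :=
      Finset.prod_congr rfl fun i _ => by ring
    rw [h, ih, pow_zero, mul_one, mul_add]
    have hx : (∑ k ∈ Finset.range (n + 1),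
        qBinomial Q n k * Q ^ k.choose 2 * (y * Q) ^ k * x ^ (n - k)) * x =
        (∑ k ∈ Finset.range (n + 1), Q ^ (k + 1) * qBinomial Q n (k + 1) *
          Q ^ (k + 1).choose 2 * y ^ (k + 1) * x ^ (n + 1 - (k + 1))) + x ^ (n + 1) := by
      rw [Finset.sum_range_succ', Finset.sum_range_succ _ n, qBinomial_eq_zero Q (Nat.lt_succ_self n),
        add_mul, Finset.sum_mul]
      simp only [qBinomial_zero_right, Nat.choose_zero_succ, mul_zero, zero_mul, add_zero, pow_zero,
        Nat.sub_zero, pow_succ, mul_one, one_mul]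
      congr 1
      refine Finset.sum_congr rfl fun k hk => ?_
      obtain ⟨l, rfl⟩ := Nat.exists_eq_add_of_lt (Finset.mem_range.mp hk)
      rw [show k + l + 1 - (k + 1) = l by omega, show k + l + 1 + 1 - (k + 1) = l + 1 by omega]
      ring
    rw [hx, Finset.sum_mul]
    simp only [qBinomial, Nat.choose_zero_succ, pow_zero, mul_one, one_mul,
      Nat.sub_zero]
    rw [add_comm (_ + x ^ (n + 1)), ← add_assoc, ← Finset.sum_add_distrib]
    congr 1
    refine Finset.sum_congr rfl fun k _ => ?_
    rw [Nat.choose_succ_succ' k 1, Nat.choose_one_right, show n + 1 - (k + 1) = n - k by omega]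
    ring

theorem map_qBinomial {S : Type*} [CommRing S] (f : R →+* S) (n k : ℕ) :
    f (qBinomial Q n k) = qBinomial (f Q) n k := by
  induction n generalizing k with
  | zero => cases k <;> simp [qBinomial]
  | succ n ih => cases k <;> simp [qBinomial, ih]

end qBinomial

/-! ### Euler products and their truncations -/

/-- The product `f_k`, with complex coefficients. -/
noncomputable def eulerProduct (k : ℕ) : ℂ⟦X⟧ := PowerSeries.map (algebraMap ℚ ℂ) (fProd k)

theorem X_pow_dvd_qPochhammer_sub {R : Type*} [CommRing R] {k : ℕ} (hk : 0 < k) {m n : ℕ}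
    (h : m ≤ n) : (PowerSeries.X : R⟦X⟧) ^ (m + 1) ∣
      qPochhammer (PowerSeries.X ^ k) n - qPochhammer (PowerSeries.X ^ k) m := by
  induction n, h using Nat.le_induction with
  | base => simp
  | succ n hn ih =>
    rw [qPochhammer_succ]
    have h1 : (PowerSeries.X : R⟦X⟧) ^ (m + 1) ∣ (PowerSeries.X ^ k) ^ (n + 1) := by
      rw [← pow_mul]
      exact pow_dvd_pow _ (by nlinarith)
    convert ih.sub (h1.mul_left (qPochhammer (PowerSeries.X ^ k) n)) using 1
    ring

/-- Every factor after the `m`-th is 1 up to order `m`, so these coefficients of the partial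
products are already constant and equal their limit. -/
theorem X_pow_dvd_fProd_sub {k : ℕ} (hk : 0 < k) (m : ℕ) :
    (PowerSeries.X : ℚ⟦X⟧) ^ (m + 1) ∣ fProd k - qPochhammer (PowerSeries.X ^ k) m := by
  rw [PowerSeries.X_pow_dvd_iff]
  intro i hi
  have h1 := (multipliable_fProd hk).hasProd.tendsto_prod_nat
  rw [PowerSeries.WithPiTopology.tendsto_iff_coeff_tendsto] at h1
  have h2 : Filter.Tendsto (fun _ : ℕ => PowerSeries.coeff i
      (qPochhammer ((PowerSeries.X : ℚ⟦X⟧) ^ k) m)) Filter.atTop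
      (nhds (PowerSeries.coeff i (fProd k))) := by
    refine (h1 i).congr' ?_
    filter_upwards [Filter.eventually_ge_atTop m] with n hn
    have := PowerSeries.X_pow_dvd_iff.mp (X_pow_dvd_qPochhammer_sub (R := ℚ) hk hn) i hi
    rw [map_sub, sub_eq_zero] at this
    rw [← this, qPochhammer]
    simp_rw [pow_mul]
  rw [map_sub, sub_eq_zero]
  exact tendsto_nhds_unique h2 tendsto_const_nhds |>.symm ▸ rfl

theorem X_pow_dvd_eulerProduct_sub {k : ℕ} (hk : 0 < k) (m : ℕ) :
    (PowerSeries.X : ℂ⟦X⟧) ^ (m + 1) ∣ eulerProduct k - qPochhammer (PowerSeries.X ^ k) m := by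
  have := map_dvd (PowerSeries.map (algebraMap ℚ ℂ)) (X_pow_dvd_fProd_sub hk m)
  simpa [qPochhammer, eulerProduct] using this

theorem isUnit_eulerProduct {k : ℕ} (hk : 0 < k) : IsUnit (eulerProduct k) := by
  refine IsUnit.map _ ?_
  rw [PowerSeries.isUnit_iff_constantCoeff, constantCoeff_fProd hk]
  exact isUnit_one

theorem dilate_eulerProduct (j : ℕ) [NeZero j] {k l : ℕ} (hk : 0 < k) (h : j * k = l) :
    dilate j (eulerProduct k) = eulerProduct l := by
  subst h
  have hj := Nat.pos_of_ne_zero (NeZero.ne j)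
  refine powerSeries_eq_of_forall_X_pow_dvd fun d => ?_
  have h1 := map_dvd (dilate j) (X_pow_dvd_eulerProduct_sub hk d)
  have h2 := X_pow_dvd_eulerProduct_sub (Nat.mul_pos hj hk) d
  rw [map_pow, dilate_X, map_sub, ← pow_mul] at h1
  have h3 : dilate j (qPochhammer (PowerSeries.X ^ k) d) =
      qPochhammer (PowerSeries.X ^ (j * k)) d := by
    simp only [qPochhammer, map_prod, map_sub, map_one, map_pow, dilate_X, ← pow_mul, mul_assoc]
  rw [h3] at h1
  have h4 := ((pow_dvd_pow _ (by nlinarith)).trans h1).sub ((pow_dvd_pow _ (Nat.le_succ d)).trans h2)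
  simpa using h4

/-- In the quotient formula for the Gaussian binomial all three finite products approximate
`eulerProduct c`, so the binomial tends to its inverse when both lower indices grow. -/
theorem X_pow_dvd_eulerProduct_mul_qBinomial_sub {c : ℕ} (hc : 0 < c) {i l d : ℕ} (hi : d ≤ i + 1)
    (hl : d ≤ l + 1) : (PowerSeries.X : ℂ⟦X⟧) ^ d ∣
      eulerProduct c * qBinomial (PowerSeries.X ^ c) (l + i) i - 1 := by
  have h1 := (pow_dvd_pow _ hi).trans (X_pow_dvd_eulerProduct_sub hc i)
  have h2 := (pow_dvd_pow _ hl).trans (X_pow_dvd_eulerProduct_sub hc l)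
  have h3 := (pow_dvd_pow _ (by omega : d ≤ l + i + 1)).trans (X_pow_dvd_eulerProduct_sub hc (l + i))
  rw [← (isUnit_eulerProduct hc).dvd_mul_left]
  set f := eulerProduct c
  set G := qBinomial ((PowerSeries.X : ℂ⟦X⟧) ^ c) (l + i) i
  have h := qBinomial_mul ((PowerSeries.X : ℂ⟦X⟧) ^ c) l i
  convert ((h1.mul_left (G * f)).add (h2.mul_left (G * qPochhammer (PowerSeries.X ^ c) i))).sub h3
    using 1
  linear_combination h

/-- Congruences become equalities in a quotient ring, where they can be used for rewriting. -/
theorem X_pow_dvd_sub_iff {d : ℕ} {f g : ℂ⟦X⟧} :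
    PowerSeries.X ^ d ∣ f - g ↔
      Ideal.Quotient.mk (Ideal.span {(PowerSeries.X : ℂ⟦X⟧) ^ d}) f =
        Ideal.Quotient.mk (Ideal.span {(PowerSeries.X : ℂ⟦X⟧) ^ d}) g := by
  rw [Ideal.Quotient.eq, Ideal.mem_span_singleton]

/-! ### The Jacobi triple product -/

theorem two_mul_choose_two (n : ℕ) : (2 : ℤ) * (n.choose 2 : ℕ) = n * (n - 1) := by
  have := Nat.triangle_succ (n - 1)
  induction n with
  | zero => simp
  | succ n ih =>
    rw [Nat.choose_succ_succ' n 1, Nat.choose_one_right]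
    push_cast
    push_cast at ih
    linarith [ih (Nat.triangle_succ _)]

/-- This is the q-binomial theorem for 2n factors with x = q^(cn-a) and y = ε, after pulling the
smaller power of q out of each factor. The sum is recentred at k = n. Only ε = ±1 is needed, so ε⁻¹
= ε. -/
theorem finite_jacobi_triple_product {a b c : ℕ} (hab : a + b = c) {ε : ℂ} (hε : ε * ε = 1)
    {w : ℤ → ℤ} (hw : ∀ j, 2 * w j = c * j ^ 2 + (a - b) * j) (hw₀ : ∀ j, 0 ≤ w j) {n : ℕ}
    (hn : 0 < n) :
    ∏ i ∈ Finset.range n, ((1 + PowerSeries.C ε * PowerSeries.X ^ (c * i + a)) *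
        (1 + PowerSeries.C ε * PowerSeries.X ^ (c * i + b))) =
      ∑ k ∈ Finset.range (n + n + 1), PowerSeries.C (ε ^ ((k : ℤ) - n)) *
        PowerSeries.X ^ (w (k - n)).toNat * qBinomial (PowerSeries.X ^ c) (n + n) k := by
  have hε0 : ε ≠ 0 := left_ne_zero_of_mul_eq_one hε
  have hac : a ≤ c * n := by nlinarith
  have hprod : ∏ i ∈ Finset.range (n + n),
      (PowerSeries.X ^ (c * n - a) + PowerSeries.C ε * (PowerSeries.X ^ c) ^ i) =
      PowerSeries.C (ε ^ n) * PowerSeries.X ^ (c * n.choose 2 + (c * n - a) * n) *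
      ∏ i ∈ Finset.range n, ((1 + PowerSeries.C ε * PowerSeries.X ^ (c * i + a)) *
        (1 + PowerSeries.C ε * PowerSeries.X ^ (c * i + b))) := by
    -- For i < n the power q^(ci) is the smaller one; reversing the order of these factors makes the
    -- exponents ci + b increasing.
    have h1 : ∏ i ∈ Finset.range n,
        (PowerSeries.X ^ (c * n - a) + PowerSeries.C ε * (PowerSeries.X ^ c) ^ i) =
        ∏ i ∈ Finset.range n, (PowerSeries.C ε * (PowerSeries.X ^ c) ^ (n - 1 - i) *
          (1 + PowerSeries.C ε * PowerSeries.X ^ (c * i + b))) := by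
      rw [← Finset.prod_range_reflect]
      refine Finset.prod_congr rfl fun i hi => ?_
      obtain ⟨l, rfl⟩ := Nat.exists_eq_add_of_lt (Finset.mem_range.mp hi)
      have h : c * (i + l + 1) - a = c * l + (c * i + b) := by
        apply Nat.sub_eq_of_eq_add
        rw [← hab]
        ring
      have h2 : PowerSeries.C ε * PowerSeries.C ε = 1 := by rw [← map_mul, hε, map_one]
      rw [h, show i + l + 1 - 1 - i = l by omega, pow_add, pow_mul]
      linear_combination -(PowerSeries.X ^ c) ^ l * PowerSeries.X ^ (c * i + b) * h2
    have h2 : ∏ i ∈ Finset.range n,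
        (PowerSeries.X ^ (c * n - a) + PowerSeries.C ε * (PowerSeries.X ^ c) ^ (n + i)) =
        ∏ i ∈ Finset.range n, (PowerSeries.X ^ (c * n - a) *
          (1 + PowerSeries.C ε * PowerSeries.X ^ (c * i + a))) := by
      refine Finset.prod_congr rfl fun i _ => ?_
      rw [← pow_mul, show c * (n + i) = c * n - a + (c * i + a) by
        rw [mul_add]; omega, pow_add]
      ring
    rw [Finset.prod_range_add, h1, h2, Finset.prod_mul_distrib, Finset.prod_mul_distrib,
      Finset.prod_mul_distrib, Finset.prod_mul_distrib, Finset.prod_range_reflect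
        (fun i => ((PowerSeries.X : ℂ⟦X⟧) ^ c) ^ i), Finset.prod_pow_eq_pow_sum,
      Finset.sum_range_id, ← Nat.choose_two_right]
    simp only [Finset.prod_const, Finset.card_range, map_pow, pow_add, pow_mul]
    ring
  have hX : PowerSeries.C (ε ^ n) * (PowerSeries.X : ℂ⟦X⟧) ^ (c * n.choose 2 + (c * n - a) * n) ≠ 0 := by
    refine mul_ne_zero ?_ (pow_ne_zero _ PowerSeries.X_ne_zero)
    simpa using pow_ne_zero n hε0
  refine mul_left_cancel₀ hX ?_
  rw [← hprod, qBinomial_theorem, Finset.mul_sum]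
  refine Finset.sum_congr rfl fun k hk => ?_
  have hk' : k ≤ n + n := Nat.lt_succ_iff.mp (Finset.mem_range.mp hk)
  have hexp : c * k.choose 2 + (c * n - a) * (n + n - k) =
      c * n.choose 2 + (c * n - a) * n + (w (k - n)).toNat := by
    zify [hac, hk']
    rw [Int.toNat_of_nonneg (hw₀ _)]
    have h1 := two_mul_choose_two k
    have h2 := two_mul_choose_two n
    have h3 := hw (k - n)
    have h4 : (b : ℤ) = c - a := by rw [← hab]; push_cast; ring
    rw [h4] at h3
    have h5 : (2 : ℤ) * (c * (k.choose 2 : ℕ) + (c * n - a) * (n + n - k)) =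
      2 * (c * (n.choose 2 : ℕ) + (c * n - a) * n + w (k - n)) := by
      linear_combination (c : ℤ) * h1 - (c : ℤ) * h2 - h3
    linarith
  have hεk : ε ^ k = ε ^ n * ε ^ ((k : ℤ) - n) := by
    rw [← zpow_natCast, ← zpow_natCast, ← zpow_add₀ hε0]
    congr 1
    ring
  have : (PowerSeries.X ^ c) ^ k.choose 2 * ((PowerSeries.X : ℂ⟦X⟧) ^ (c * n - a)) ^ (n + n - k) =
      PowerSeries.X ^ (c * n.choose 2 + (c * n - a) * n) * PowerSeries.X ^ (w (k - n)).toNat := by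
    rw [← pow_mul, ← pow_mul, ← pow_add, ← pow_add, hexp]
  rw [← map_pow, hεk, map_mul]
  linear_combination qBinomial (PowerSeries.X ^ c) (n + n) k * PowerSeries.C (ε ^ n) *
    PowerSeries.C (ε ^ ((k : ℤ) - n)) * this

/-- A term that already carries `X ^ e` needs its cofactor only to precision `d - e`. -/
theorem X_pow_dvd_C_mul_X_pow_mul {d e : ℕ} {f : ℂ⟦X⟧} (a : ℂ)
    (h : PowerSeries.X ^ (d - e) ∣ f) :
    PowerSeries.X ^ d ∣ PowerSeries.C a * PowerSeries.X ^ e * f := by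
  rw [mul_assoc]
  refine Dvd.dvd.mul_left ((pow_dvd_pow PowerSeries.X (by omega : d ≤ e + (d - e))).trans ?_) _
  rw [pow_add]
  exact mul_dvd_mul_left _ h

theorem jacobi_triple_product {a b c : ℕ} (ha : 0 < a) (hb : 0 < b) (hab : a + b = c) {ε : ℂ}
    (hε : ε * ε = 1) {w : ℤ → ℤ} (hw : ∀ j, 2 * w j = c * j ^ 2 + (a - b) * j) {d n : ℕ}
    (hd : d ≤ n) (hn : 0 < n) :
    PowerSeries.X ^ d ∣ thetaSeries (fun j : ℤ => ε ^ j) w - eulerProduct c *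
      ∏ i ∈ Finset.range n, ((1 + PowerSeries.C ε * PowerSeries.X ^ (c * i + a)) *
        (1 + PowerSeries.C ε * PowerSeries.X ^ (c * i + b))) := by
  have hwj : ∀ j, |j| ≤ w j := fun j => by
    have h1 := hw j
    have h2 := Int.le_self_sq j
    have h3 := Int.le_self_sq (-j)
    -- From 2w = a(j² + j) + b(j² - j) with both brackets nonnegative and a, b ≥ 1 it follows that w
    -- ≥ j² ≥ |j|.
    have h4 : (0 : ℤ) ≤ (a - 1) * (j ^ 2 + j) :=
      mul_nonneg (by omega) (by linarith [neg_sq j])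
    have h5 : (0 : ℤ) ≤ (b - 1) * (j ^ 2 - j) := mul_nonneg (by omega) (by linarith)
    have h6 : (c : ℤ) = a + b := by rw [← hab]; push_cast; ring
    rw [h6] at h1
    rw [neg_sq] at h3
    rcases abs_cases j with h | h <;> nlinarith
  have hadm := admissible_int hwj
  have hinj : Function.Injective fun k : ℕ => (k : ℤ) - n := fun x y h => by
    simpa using h
  have h1 := X_pow_dvd_thetaSeries_sub (fun j : ℤ => ε ^ j) hadm d
    (A := (Finset.range (n + n + 1)).image fun k : ℕ => (k : ℤ) - n) (fun j hj => by
      have := hwj j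
      rw [abs_le] at this
      exact Finset.mem_image.mpr ⟨(j + n).toNat, Finset.mem_range.mpr (by omega), by omega⟩)
  rw [Finset.sum_image fun _ _ _ _ h => hinj h] at h1
  rw [finite_jacobi_triple_product hab hε hw hadm.nonneg hn]
  have h2 : PowerSeries.X ^ d ∣ eulerProduct c * (∑ k ∈ Finset.range (n + n + 1),
      PowerSeries.C (ε ^ ((k : ℤ) - n)) * PowerSeries.X ^ (w (k - n)).toNat *
        qBinomial (PowerSeries.X ^ c) (n + n) k) - ∑ k ∈ Finset.range (n + n + 1),
      PowerSeries.C (ε ^ ((k : ℤ) - n)) * PowerSeries.X ^ (w (k - n)).toNat := by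
    rw [Finset.mul_sum, ← Finset.sum_sub_distrib]
    refine Finset.dvd_sum fun k hk => ?_
    have hk' : k ≤ n + n := Nat.lt_succ_iff.mp (Finset.mem_range.mp hk)
    have h3 := hwj (k - n)
    rw [abs_le] at h3
    obtain ⟨l, hl⟩ := Nat.exists_eq_add_of_le' hk'
    -- With j = k - n, both k = n + j and l = n - j are at least d - |j|, hence at least d - w(j):
    -- the binomial is precise enough exactly where it is needed.
    have h4 := X_pow_dvd_eulerProduct_mul_qBinomial_sub (c := c) (i := k) (l := l)
      (d := d - (w (k - n)).toNat) (by omega) (by omega) (by omega)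
    rw [← hl] at h4
    have h5 := X_pow_dvd_C_mul_X_pow_mul (ε ^ ((k : ℤ) - n)) h4
    convert h5 using 1
    ring
  convert h1.sub h2 using 1
  ring

/-! ### Product formulas for ψ(q), f(q, q²) and φ(-q) -/

theorem psiTheta_mul_eulerProduct : psiTheta * eulerProduct 1 = eulerProduct 2 ^ 2 := by
  refine powerSeries_eq_of_forall_X_pow_dvd fun d => ?_
  have h := jacobi_triple_product (a := 3) (b := 1) (c := 4) (ε := 1) (w := triangularForm)
    (by norm_num) (by norm_num) rfl (by norm_num)
    (fun j => by simp only [triangularForm]; push_cast; ring) (Nat.le_succ d) (Nat.succ_pos d)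
  -- The finite form of ∏(1 + q^m) over odd m, by 1 + q^m = (1 - q^(2m))/(1 - q^m). The lengths 4n
  -- and 2n are chosen so that all products stop at matching exponents and the induction closes
  -- exactly.
  have hfin : ∀ n : ℕ, (∏ i ∈ Finset.range n,
      ((1 + PowerSeries.C (1 : ℂ) * PowerSeries.X ^ (4 * i + 3)) *
        (1 + PowerSeries.C 1 * PowerSeries.X ^ (4 * i + 1)))) *
      qPochhammer (PowerSeries.X ^ 1) (4 * n) * qPochhammer (PowerSeries.X ^ 4) (2 * n) =
      qPochhammer (PowerSeries.X ^ 2) (2 * n) * qPochhammer (PowerSeries.X ^ 2) (4 * n) := by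
    intro n
    induction n with
    | zero => simp [qPochhammer]
    | succ n ih =>
      rw [Finset.prod_range_succ, show 4 * (n + 1) = 4 * n + 1 + 1 + 1 + 1 by ring,
        show 2 * (n + 1) = 2 * n + 1 + 1 by ring]
      simp only [qPochhammer_succ, map_one, ← pow_mul, one_mul] at ih ⊢
      rw [show 4 * (2 * n + 1) = 2 * (4 * n + 1 + 1) by ring,
        show 4 * (2 * n + 1 + 1) = 2 * (4 * n + 1 + 1 + 1 + 1) by ring,
        show 2 * (2 * n + 1) = 4 * n + 1 + 1 by ring,
        show 2 * (2 * n + 1 + 1) = 4 * n + 1 + 1 + 1 + 1 by ring,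
        show 4 * n + 3 = 4 * n + 1 + 1 + 1 by ring, mul_comm 2 (4 * n + 1),
        mul_comm 2 (4 * n + 1 + 1 + 1), pow_mul _ (4 * n + 1), pow_mul _ (4 * n + 1 + 1 + 1)]
      generalize (PowerSeries.X : ℂ⟦X⟧) ^ (4 * n + 1) = A
      generalize (PowerSeries.X : ℂ⟦X⟧) ^ (4 * n + 1 + 1) = B
      generalize (PowerSeries.X : ℂ⟦X⟧) ^ (4 * n + 1 + 1 + 1) = C
      generalize (PowerSeries.X : ℂ⟦X⟧) ^ (4 * n + 1 + 1 + 1 + 1) = D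
      generalize (PowerSeries.X : ℂ⟦X⟧) ^ (2 * (4 * n + 1 + 1)) = E
      generalize (PowerSeries.X : ℂ⟦X⟧) ^ (2 * (4 * n + 1 + 1 + 1 + 1)) = F
      linear_combination (1 - A ^ 2) * (1 - B) * (1 - C ^ 2) * (1 - D) * (1 - E) * (1 - F) * ih
  have hE : ∀ k, 0 < k → ∀ n, d ≤ n + 1 → _ := fun k hk n hn =>
    X_pow_dvd_sub_iff.mp ((pow_dvd_pow _ hn).trans (X_pow_dvd_eulerProduct_sub hk n))
  have hf := congrArg (Ideal.Quotient.mk (Ideal.span {(PowerSeries.X : ℂ⟦X⟧) ^ d})) (hfin (d + 1))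
  rw [X_pow_dvd_sub_iff] at h ⊢
  simp only [one_zpow] at h
  rw [← psiTheta] at h
  simp only [map_mul, map_pow] at h hf ⊢
  rw [h, hE 4 (by norm_num) (2 * (d + 1)) (by omega), hE 1 (by norm_num) (4 * (d + 1)) (by omega)]
  have h1 := hE 2 (by norm_num) (2 * (d + 1)) (by omega)
  have h2 := hE 2 (by norm_num) (4 * (d + 1)) (by omega)
  rw [sq]
  nth_rw 1 [h1]
  rw [h2, ← hf]
  ring

theorem pentagonalTheta_mul_eulerProduct :
    pentagonalTheta * eulerProduct 1 * eulerProduct 6 = eulerProduct 2 * eulerProduct 3 ^ 2 := by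
  refine powerSeries_eq_of_forall_X_pow_dvd fun d => ?_
  have h := jacobi_triple_product (a := 2) (b := 1) (c := 3) (ε := 1) (w := pentagonalForm)
    (by norm_num) (by norm_num) rfl (by norm_num)
    (fun j => by rw [two_mul_pentagonalForm]; push_cast; ring) (Nat.le_succ d) (Nat.succ_pos d)
  have hfin : ∀ n : ℕ, (∏ i ∈ Finset.range n,
      ((1 + PowerSeries.C (1 : ℂ) * PowerSeries.X ^ (3 * i + 2)) *
        (1 + PowerSeries.C 1 * PowerSeries.X ^ (3 * i + 1)))) *
      qPochhammer (PowerSeries.X ^ 1) (3 * n) * qPochhammer (PowerSeries.X ^ 6) n =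
      qPochhammer (PowerSeries.X ^ 2) (3 * n) * qPochhammer (PowerSeries.X ^ 3) n := by
    intro n
    induction n with
    | zero => simp [qPochhammer]
    | succ n ih =>
      rw [Finset.prod_range_succ, show 3 * (n + 1) = 3 * n + 1 + 1 + 1 by ring]
      simp only [qPochhammer_succ, map_one, ← pow_mul, one_mul] at ih ⊢
      rw [show 6 * (n + 1) = 2 * (3 * n + 1 + 1 + 1) by ring,
        show 3 * (n + 1) = 3 * n + 1 + 1 + 1 by ring, mul_comm 2 (3 * n + 1),
        mul_comm 2 (3 * n + 1 + 1), mul_comm 2 (3 * n + 1 + 1 + 1), pow_mul _ (3 * n + 1),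
        pow_mul _ (3 * n + 1 + 1), pow_mul _ (3 * n + 1 + 1 + 1)]
      generalize (PowerSeries.X : ℂ⟦X⟧) ^ (3 * n + 1) = A
      generalize (PowerSeries.X : ℂ⟦X⟧) ^ (3 * n + 1 + 1) = B
      generalize (PowerSeries.X : ℂ⟦X⟧) ^ (3 * n + 1 + 1 + 1) = C
      linear_combination (1 - A ^ 2) * (1 - B ^ 2) * (1 - C) * (1 - C ^ 2) * ih
  have hE : ∀ k, 0 < k → ∀ n, d ≤ n + 1 → _ := fun k hk n hn =>
    X_pow_dvd_sub_iff.mp ((pow_dvd_pow _ hn).trans (X_pow_dvd_eulerProduct_sub hk n))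
  have hf := congrArg (Ideal.Quotient.mk (Ideal.span {(PowerSeries.X : ℂ⟦X⟧) ^ d})) (hfin (d + 1))
  rw [X_pow_dvd_sub_iff] at h ⊢
  simp only [one_zpow] at h
  rw [← pentagonalTheta] at h
  simp only [map_mul, map_pow] at h hf ⊢
  rw [h, hE 6 (by norm_num) (d + 1) (by omega), hE 1 (by norm_num) (3 * (d + 1)) (by omega),
    hE 2 (by norm_num) (3 * (d + 1)) (by omega), hE 3 (by norm_num) (d + 1) (by omega)]
  linear_combination Ideal.Quotient.mk _ (qPochhammer (PowerSeries.X ^ 3) (d + 1)) * hf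

theorem altSquareTheta_mul_eulerProduct : altSquareTheta * eulerProduct 2 = eulerProduct 1 ^ 2 := by
  refine powerSeries_eq_of_forall_X_pow_dvd fun d => ?_
  have h := jacobi_triple_product (a := 1) (b := 1) (c := 2) (ε := -1) (w := fun n => n ^ 2)
    (by norm_num) (by norm_num) rfl (by norm_num)
    (fun j => by push_cast; ring) (Nat.le_succ d) (Nat.succ_pos d)
  have hfin : ∀ n : ℕ, (∏ i ∈ Finset.range n,
      ((1 + PowerSeries.C (-1 : ℂ) * PowerSeries.X ^ (2 * i + 1)) *
        (1 + PowerSeries.C (-1) * PowerSeries.X ^ (2 * i + 1)))) *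
      qPochhammer (PowerSeries.X ^ 2) n ^ 2 = qPochhammer (PowerSeries.X ^ 1) (2 * n) ^ 2 := by
    intro n
    induction n with
    | zero => simp [qPochhammer]
    | succ n ih =>
      rw [Finset.prod_range_succ, show 2 * (n + 1) = 2 * n + 1 + 1 by ring]
      simp only [qPochhammer_succ, map_one, map_neg, ← pow_mul, one_mul] at ih ⊢
      rw [show 2 * (n + 1) = 2 * n + 1 + 1 by ring]
      generalize (PowerSeries.X : ℂ⟦X⟧) ^ (2 * n + 1) = A
      generalize (PowerSeries.X : ℂ⟦X⟧) ^ (2 * n + 1 + 1) = B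
      linear_combination (1 - A) ^ 2 * (1 - B) ^ 2 * ih
  have hE : ∀ k, 0 < k → ∀ n, d ≤ n + 1 → _ := fun k hk n hn =>
    X_pow_dvd_sub_iff.mp ((pow_dvd_pow _ hn).trans (X_pow_dvd_eulerProduct_sub hk n))
  have hf := congrArg (Ideal.Quotient.mk (Ideal.span {(PowerSeries.X : ℂ⟦X⟧) ^ d})) (hfin (d + 1))
  rw [X_pow_dvd_sub_iff] at h ⊢
  rw [← altSquareTheta] at h
  simp only [map_mul, map_pow] at h hf ⊢
  rw [h, hE 2 (by norm_num) (d + 1) (by omega), hE 1 (by norm_num) (2 * (d + 1)) (by omega)]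
  linear_combination hf

/-! ### Product formulas for the cubic theta series -/

/-- The index set of the middle coefficient of a product of three polynomials. -/
def middleIndices (n : ℕ) : Finset (ℕ × ℕ) :=
  {p ∈ Finset.range (n + n + 1) ×ˢ Finset.range (n + n + 1) | n ≤ p.1 + p.2 ∧ p.1 + p.2 ≤ 3 * n}

/-- Two of the exponents determine the third, as their sum is 3n; the bounds in `middleIndices` say
that the third lies between 0 and 2n. -/
theorem coeff_middle_mul (g₀ g₁ g₂ : ℕ → ℂ⟦X⟧) (n : ℕ) :
    ((∑ k ∈ Finset.range (n + n + 1), Polynomial.C (g₀ k) * Polynomial.X ^ k) *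
      (∑ k ∈ Finset.range (n + n + 1), Polynomial.C (g₁ k) * Polynomial.X ^ k) *
      (∑ k ∈ Finset.range (n + n + 1), Polynomial.C (g₂ k) * Polynomial.X ^ k)).coeff (3 * n) =
    ∑ p ∈ middleIndices n, g₀ (3 * n - (p.1 + p.2)) * g₁ p.1 * g₂ p.2 := by
  rw [mul_assoc, Finset.sum_mul_sum (Finset.range (n + n + 1)) (Finset.range (n + n + 1)) _ _,
    ← Finset.sum_product', Finset.sum_mul_sum, Finset.sum_comm, Polynomial.finsetSum_coeff,
    middleIndices, Finset.sum_filter]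
  refine Finset.sum_congr rfl fun p hp => ?_
  rw [Finset.mem_product, Finset.mem_range, Finset.mem_range] at hp
  rw [Polynomial.finsetSum_coeff]
  have h : ∀ k, (Polynomial.C (g₀ k) * Polynomial.X ^ k * (Polynomial.C (g₁ p.1) *
      Polynomial.X ^ p.1 * (Polynomial.C (g₂ p.2) * Polynomial.X ^ p.2))).coeff (3 * n) =
      if k + (p.1 + p.2) = 3 * n then g₀ k * g₁ p.1 * g₂ p.2 else 0 := fun k => by
    rw [show Polynomial.C (g₀ k) * Polynomial.X ^ k * (Polynomial.C (g₁ p.1) *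
      Polynomial.X ^ p.1 * (Polynomial.C (g₂ p.2) * Polynomial.X ^ p.2)) =
      Polynomial.C (g₀ k * g₁ p.1 * g₂ p.2) * Polynomial.X ^ (k + (p.1 + p.2)) by
        simp only [map_mul]; ring, Polynomial.coeff_C_mul_X_pow]
    simp only [eq_comm]
  simp only [h]
  split_ifs with h1
  · rw [Finset.sum_eq_single (3 * n - (p.1 + p.2)), if_pos (by omega)]
    · intro k _ hk
      exact if_neg (by omega)
    · intro hk
      rw [Finset.mem_range] at hk
      omega
  · refine Finset.sum_eq_zero fun k hk => if_neg ?_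
    rw [Finset.mem_range] at hk
    omega

/-- The polynomial variable plays the role of z in ∏(1 + αzQ^i), over power series in q. -/
theorem prod_one_add_eq_sum (α Q : ℂ⟦X⟧) (n : ℕ) :
    ∏ i ∈ Finset.range n, (1 + Polynomial.C α * Polynomial.X * Polynomial.C Q ^ i) =
      ∑ k ∈ Finset.range (n + 1),
        Polynomial.C (qBinomial Q n k * Q ^ k.choose 2 * α ^ k) * Polynomial.X ^ k := by
  rw [qBinomial_theorem]
  refine Finset.sum_congr rfl fun k _ => ?_
  rw [← map_qBinomial, one_pow]
  simp only [map_mul, map_pow]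
  ring

/-- Exponents i + j + k = 3n, centred at n, become -(u+v), u, v. Half the sum of their squares is u²
+ uv + v², so the middle coefficient of three q-binomial expansions is a truncated theta series of
the Eisenstein form, up to a fixed power of q. -/
theorem coeff_middle_prod {ε : ℂ} (hε : ε ^ 3 = 1) (c s : ℕ) {w : ℤ × ℤ → ℤ} (hw₀ : ∀ p, 0 ≤ w p)
    (hw : ∀ p, w p = c * eisensteinForm p + s * (p.1 + 2 * p.2)) (n : ℕ) :
    ((∏ i ∈ Finset.range (n + n), (1 + Polynomial.C (1 : ℂ⟦X⟧) * Polynomial.X *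
        Polynomial.C (PowerSeries.X ^ c) ^ i)) *
      (∏ i ∈ Finset.range (n + n), (1 + Polynomial.C (PowerSeries.C ε * PowerSeries.X ^ s) *
        Polynomial.X * Polynomial.C (PowerSeries.X ^ c) ^ i)) *
      (∏ i ∈ Finset.range (n + n), (1 + Polynomial.C (PowerSeries.C (ε ^ 2) *
        PowerSeries.X ^ (2 * s)) * Polynomial.X *
        Polynomial.C (PowerSeries.X ^ c) ^ i))).coeff (3 * n) =
    PowerSeries.X ^ (3 * c * n.choose 2 + 3 * s * n) *
      ∑ p ∈ middleIndices n, PowerSeries.C (ε ^ (((p.1 : ℤ) - n) - (p.2 - n))) *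
        PowerSeries.X ^ (w ((p.1 : ℤ) - n, (p.2 : ℤ) - n)).toNat *
        (qBinomial (PowerSeries.X ^ c) (n + n) (3 * n - (p.1 + p.2)) *
          qBinomial (PowerSeries.X ^ c) (n + n) p.1 *
          qBinomial (PowerSeries.X ^ c) (n + n) p.2) := by
  have hε0 : ε ≠ 0 := by
    rintro rfl
    norm_num at hε
  rw [prod_one_add_eq_sum, prod_one_add_eq_sum, prod_one_add_eq_sum, coeff_middle_mul,
    Finset.mul_sum]
  refine Finset.sum_congr rfl fun ⟨j, k⟩ hp => ?_
  rw [middleIndices, Finset.mem_filter] at hp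
  dsimp only at hp ⊢
  obtain ⟨i, hi⟩ := Nat.exists_eq_add_of_le' hp.2.2
  rw [show 3 * n - (j + k) = i by omega]
  have hexp : c * i.choose 2 + (c * j.choose 2 + s * j) + (c * k.choose 2 + 2 * s * k) =
      3 * c * n.choose 2 + 3 * s * n + (w ((j : ℤ) - n, (k : ℤ) - n)).toNat := by
    zify
    rw [Int.toNat_of_nonneg (hw₀ _), hw, eisensteinForm]
    have h1 := two_mul_choose_two i
    have h2 := two_mul_choose_two j
    have h3 := two_mul_choose_two k
    have h4 := two_mul_choose_two n
    have hi' : (i : ℤ) = 3 * n - j - k := by omega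
    rw [hi'] at h1
    dsimp only
    linarith [congrArg (fun x => (c : ℤ) * x) h1, congrArg (fun x => (c : ℤ) * x) h2,
      congrArg (fun x => (c : ℤ) * x) h3, congrArg (fun x => (c : ℤ) * x) h4]
  have hεk : ε ^ j * (ε ^ 2) ^ k = ε ^ (((j : ℤ) - n) - (k - n)) := by
    rw [show ((j : ℤ) - n) - (k - n) = j - k by ring, zpow_sub₀ hε0, zpow_natCast, zpow_natCast,
      eq_div_iff (pow_ne_zero _ hε0), mul_assoc, ← mul_pow, ← pow_succ, hε, one_pow, mul_one]
  have hX : ((PowerSeries.X : ℂ⟦X⟧) ^ c) ^ i.choose 2 * ((PowerSeries.X ^ c) ^ j.choose 2 *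
      (PowerSeries.X ^ s) ^ j) * ((PowerSeries.X ^ c) ^ k.choose 2 *
      (PowerSeries.X ^ (2 * s)) ^ k) = PowerSeries.X ^ (3 * c * n.choose 2 + 3 * s * n) *
      PowerSeries.X ^ (w ((j : ℤ) - n, (k : ℤ) - n)).toNat := by
    simp only [← pow_mul, ← pow_add]
    rw [hexp]
  rw [← hεk, map_mul, map_pow _ (ε ^ 2), map_pow _ _ j, one_pow, mul_pow, mul_pow]
  linear_combination qBinomial (PowerSeries.X ^ c) (n + n) i *
    qBinomial (PowerSeries.X ^ c) (n + n) j * qBinomial (PowerSeries.X ^ c) (n + n) k *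
    PowerSeries.C ε ^ j * PowerSeries.C (ε ^ 2) ^ k * hX

/-- The limit of the previous sum: each of the three binomials tends to 1/f_c. The bound on `|p.1 +
p.2|` controls the binomial with the dependent index. -/
theorem X_pow_dvd_thetaSeries_sub_middle {ε : ℂ} {c : ℕ} (hc : 0 < c) {w : ℤ × ℤ → ℤ}
    (hw : ∀ p, |p.1| ≤ w p ∧ |p.2| ≤ w p ∧ |p.1 + p.2| ≤ w p) {d n : ℕ} (hd : d ≤ n) :
    PowerSeries.X ^ d ∣ thetaSeries (fun p : ℤ × ℤ => ε ^ (p.1 - p.2)) w -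
      eulerProduct c ^ 3 * ∑ p ∈ middleIndices n,
        PowerSeries.C (ε ^ (((p.1 : ℤ) - n) - (p.2 - n))) *
        PowerSeries.X ^ (w ((p.1 : ℤ) - n, (p.2 : ℤ) - n)).toNat *
        (qBinomial (PowerSeries.X ^ c) (n + n) (3 * n - (p.1 + p.2)) *
          qBinomial (PowerSeries.X ^ c) (n + n) p.1 *
          qBinomial (PowerSeries.X ^ c) (n + n) p.2) := by
  have hadm : Admissible w := admissible_int_prod fun p => ⟨(hw p).1, (hw p).2.1⟩
  have hinj : Function.Injective fun p : ℕ × ℕ => ((p.1 : ℤ) - n, (p.2 : ℤ) - n) := by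
    rintro ⟨x, y⟩ ⟨x', y'⟩ h
    simpa using h
  have h1 := X_pow_dvd_thetaSeries_sub (fun p : ℤ × ℤ => ε ^ (p.1 - p.2)) hadm d
    (A := (middleIndices n).image fun p : ℕ × ℕ => ((p.1 : ℤ) - n, (p.2 : ℤ) - n))
    (fun ⟨x, y⟩ hj => by
      have := hw (x, y)
      simp only [abs_le] at this
      refine Finset.mem_image.mpr ⟨((x + n).toNat, (y + n).toNat), ?_, ?_⟩
      · simp only [middleIndices, Finset.mem_filter, Finset.mem_product, Finset.mem_range]
        omega
      · ext <;> dsimp only <;> omega)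
  rw [Finset.sum_image fun _ _ _ _ h => hinj h] at h1
  have h2 : PowerSeries.X ^ d ∣ eulerProduct c ^ 3 * (∑ p ∈ middleIndices n,
        PowerSeries.C (ε ^ (((p.1 : ℤ) - n) - (p.2 - n))) *
        PowerSeries.X ^ (w ((p.1 : ℤ) - n, (p.2 : ℤ) - n)).toNat *
        (qBinomial (PowerSeries.X ^ c) (n + n) (3 * n - (p.1 + p.2)) *
          qBinomial (PowerSeries.X ^ c) (n + n) p.1 *
          qBinomial (PowerSeries.X ^ c) (n + n) p.2)) - ∑ p ∈ middleIndices n,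
        PowerSeries.C (ε ^ (((p.1 : ℤ) - n) - (p.2 - n))) *
        PowerSeries.X ^ (w ((p.1 : ℤ) - n, (p.2 : ℤ) - n)).toNat := by
    rw [Finset.mul_sum, ← Finset.sum_sub_distrib]
    refine Finset.dvd_sum fun ⟨j, k⟩ hp => ?_
    simp only [middleIndices, Finset.mem_filter, Finset.mem_product, Finset.mem_range] at hp
    dsimp only
    have h3 := hw ((j : ℤ) - n, (k : ℤ) - n)
    simp only [abs_le] at h3
    have h4 : ∀ i ≤ n + n, |(i : ℤ) - n| ≤ w ((j : ℤ) - n, (k : ℤ) - n) →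
        PowerSeries.X ^ (d - (w ((j : ℤ) - n, (k : ℤ) - n)).toNat) ∣
          eulerProduct c * qBinomial (PowerSeries.X ^ c) (n + n) i - 1 := fun i hi hiw => by
      rw [abs_le] at hiw
      obtain ⟨l, hl⟩ := Nat.exists_eq_add_of_le' hi
      rw [hl]
      exact X_pow_dvd_eulerProduct_mul_qBinomial_sub hc (by omega) (by omega)
    have h5 := h4 (3 * n - (j + k)) (by omega) (by rw [abs_le]; omega)
    have h6 := h4 j (by omega) (by rw [abs_le]; omega)
    have h7 := h4 k (by omega) (by rw [abs_le]; omega)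
    have h8 := X_pow_dvd_C_mul_X_pow_mul (ε ^ (((j : ℤ) - n) - (k - n)))
      (((h5.mul_right (eulerProduct c * qBinomial (PowerSeries.X ^ c) (n + n) j *
        (eulerProduct c * qBinomial (PowerSeries.X ^ c) (n + n) k))).add
        (h6.mul_right (eulerProduct c * qBinomial (PowerSeries.X ^ c) (n + n) k))).add h7)
    convert h8 using 1
    ring
  convert h1.sub h2 using 1
  ring

/-- The middle coefficient of the product with base q³ and shifts 1, q, q² is computed twice: as a
theta sum, and as one Gaussian binomial in base q, which tends to 1/f₁. -/
theorem coreTheta_mul_eulerProduct : coreTheta * eulerProduct 1 = eulerProduct 3 ^ 3 := by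
  refine powerSeries_eq_of_forall_X_pow_dvd fun d => ?_
  have hw : ∀ p : ℤ × ℤ, |p.1| ≤ coreForm p ∧ |p.2| ≤ coreForm p ∧ |p.1 + p.2| ≤ coreForm p := by
    rintro ⟨u, v⟩
    have h1 : |u| ≤ eisensteinForm (u, v) := (abs_le_eisensteinForm _ _).1
    have h2 : |v| ≤ eisensteinForm (u, v) := (abs_le_eisensteinForm _ _).2
    have h3 : |u + v| ≤ eisensteinForm (-v, u + v) := (abs_le_eisensteinForm _ _).2
    simp only [coreForm, eisensteinForm, abs_le] at *
    refine ⟨?_, ?_, ?_⟩ <;> constructor <;> linarith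
  have h1 := X_pow_dvd_thetaSeries_sub_middle (ε := 1) (c := 3) (by norm_num) hw (le_refl d)
  have h2 := coeff_middle_prod (ε := 1) (by norm_num) 3 1 admissible_coreForm.nonneg
    (fun p => by simp only [coreForm, eisensteinForm]; push_cast; ring) d
  set S := ∑ p ∈ middleIndices d, PowerSeries.C ((1 : ℂ) ^ (((p.1 : ℤ) - d) - (p.2 - d))) *
        PowerSeries.X ^ (coreForm ((p.1 : ℤ) - d, (p.2 : ℤ) - d)).toNat *
        (qBinomial (PowerSeries.X ^ 3) (d + d) (3 * d - (p.1 + p.2)) *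
          qBinomial (PowerSeries.X ^ 3) (d + d) p.1 *
          qBinomial (PowerSeries.X ^ 3) (d + d) p.2)
  -- The exponents 3i, 3i + 1, 3i + 2 interlace into a single product with base q.
  have hprod : ∀ n : ℕ, (∏ i ∈ Finset.range n, (1 + Polynomial.C (1 : ℂ⟦X⟧) * Polynomial.X *
        Polynomial.C (PowerSeries.X ^ 3) ^ i)) *
      (∏ i ∈ Finset.range n, (1 + Polynomial.C (PowerSeries.C 1 * PowerSeries.X ^ 1) *
        Polynomial.X * Polynomial.C (PowerSeries.X ^ 3) ^ i)) *
      (∏ i ∈ Finset.range n, (1 + Polynomial.C (PowerSeries.C (1 ^ 2) *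
        PowerSeries.X ^ (2 * 1)) * Polynomial.X * Polynomial.C (PowerSeries.X ^ 3) ^ i)) =
      ∏ i ∈ Finset.range (3 * n), (1 + Polynomial.C (1 : ℂ⟦X⟧) * Polynomial.X *
        Polynomial.C PowerSeries.X ^ i) := fun n => by
    induction n with
    | zero => simp
    | succ n ih =>
      rw [show 3 * (n + 1) = 3 * n + 1 + 1 + 1 by ring]
      simp only [Finset.prod_range_succ]
      rw [← ih]
      simp only [map_one, one_pow, map_pow, one_mul, mul_one, ← pow_mul]
      rw [pow_succ _ (3 * n + 1), pow_succ _ (3 * n)]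
      ring
  rw [hprod, prod_one_add_eq_sum, Polynomial.finsetSum_coeff,
    Finset.sum_eq_single_of_mem (3 * d) (by rw [Finset.mem_range]; omega)
      (fun k _ hk => by rw [Polynomial.coeff_C_mul_X_pow, if_neg (Ne.symm hk)]),
    Polynomial.coeff_C_mul_X_pow, if_pos rfl, one_pow, mul_one, mul_comm] at h2
  have hE : 3 * 3 * d.choose 2 + 3 * 1 * d = (3 * d).choose 2 := by
    zify
    have h3 := two_mul_choose_two d
    have h4 := two_mul_choose_two (3 * d)
    push_cast at h4
    linarith
  rw [hE] at h2
  have h3 := mul_left_cancel₀ (pow_ne_zero _ PowerSeries.X_ne_zero) h2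
  have h4 := X_pow_dvd_eulerProduct_mul_qBinomial_sub (c := 1) (i := 3 * d) (l := 3 * d) (d := d)
    (by norm_num) (by omega) (by omega)
  rw [pow_one, show 3 * d + 3 * d = 3 * (d + d) by ring, h3] at h4
  have h5 := (h1.mul_right (eulerProduct 1)).add (h4.mul_left (eulerProduct 3 ^ 3))
  rw [coreTheta]
  simp only [one_zpow] at h5
  convert h5 using 1
  ring

theorem eisensteinTheta_dissection_three :
    eisensteinTheta = dilate 3 eisensteinTheta + 6 * PowerSeries.X * dilate 3 coreTheta := by
  have h := thetaSeries_eisensteinForm_mod_three (fun _ => 1) (fun _ _ => rfl)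
  rw [← eisensteinTheta, map_one, one_mul] at h
  conv_lhs => rw [h]
  rw [show (3 : ℂ) * (1 + 1) = 6 by norm_num, map_ofNat]

/-- This is the Borwein function b(q), the theta series twisted by ε^(u-v). The three products with
parameters 1, ε, ε² combine into one in z³ and q³, whose middle coefficient is a Gaussian binomial
in base q³. -/
theorem cubicTheta_mul_eulerProduct {ε : ℂ} (hε : ε ^ 2 + ε + 1 = 0) :
    (dilate 3 eisensteinTheta - 3 * PowerSeries.X * dilate 3 coreTheta) * eulerProduct 3 =
      eulerProduct 1 ^ 3 := by
  have hε3 : ε ^ 3 = 1 := by linear_combination (ε - 1) * hε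
  have hε0 : ε ≠ 0 := by
    rintro rfl
    norm_num at hε
  have hb : dilate 3 eisensteinTheta - 3 * PowerSeries.X * dilate 3 coreTheta =
      thetaSeries (fun p : ℤ × ℤ => ε ^ (p.1 - p.2)) eisensteinForm := by
    rw [thetaSeries_eisensteinForm_mod_three (fun n : ℤ => ε ^ n) (fun n k => by
      rw [zpow_add₀ hε0, zpow_mul, show (3 : ℤ) = (3 : ℕ) by rfl, zpow_natCast, hε3, one_zpow,
        mul_one])]
    have h1 : 3 * (ε ^ (1 : ℤ) + ε ^ (2 : ℤ)) = -3 := by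
      rw [zpow_one, show (2 : ℤ) = (2 : ℕ) by rfl, zpow_natCast]
      linear_combination 3 * hε
    rw [h1, map_neg, map_ofNat, zpow_zero, map_one, eisensteinTheta]
    ring
  rw [hb]
  refine powerSeries_eq_of_forall_X_pow_dvd fun d => ?_
  have hw : ∀ p : ℤ × ℤ, |p.1| ≤ eisensteinForm p ∧ |p.2| ≤ eisensteinForm p ∧
      |p.1 + p.2| ≤ eisensteinForm p := by
    rintro ⟨u, v⟩
    refine ⟨(abs_le_eisensteinForm _ _).1, (abs_le_eisensteinForm _ _).2, ?_⟩
    have h3 : |u + v| ≤ eisensteinForm (-v, u + v) := (abs_le_eisensteinForm _ _).2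
    convert h3 using 1
    simp only [eisensteinForm]
    ring
  have h1 := X_pow_dvd_thetaSeries_sub_middle (ε := ε) (c := 1) (by norm_num) hw (le_refl d)
  have h2 := coeff_middle_prod hε3 1 0 admissible_eisensteinForm.nonneg
    (fun p => by push_cast; ring) d
  set S := ∑ p ∈ middleIndices d, PowerSeries.C (ε ^ (((p.1 : ℤ) - d) - (p.2 - d))) *
        PowerSeries.X ^ (eisensteinForm ((p.1 : ℤ) - d, (p.2 : ℤ) - d)).toNat *
        (qBinomial (PowerSeries.X ^ 1) (d + d) (3 * d - (p.1 + p.2)) *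
          qBinomial (PowerSeries.X ^ 1) (d + d) p.1 *
          qBinomial (PowerSeries.X ^ 1) (d + d) p.2)
  have hprod : (∏ i ∈ Finset.range (d + d), (1 + Polynomial.C (1 : ℂ⟦X⟧) * Polynomial.X *
        Polynomial.C (PowerSeries.X ^ 1) ^ i)) *
      (∏ i ∈ Finset.range (d + d), (1 + Polynomial.C (PowerSeries.C ε * PowerSeries.X ^ 0) *
        Polynomial.X * Polynomial.C (PowerSeries.X ^ 1) ^ i)) *
      (∏ i ∈ Finset.range (d + d), (1 + Polynomial.C (PowerSeries.C (ε ^ 2) *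
        PowerSeries.X ^ (2 * 0)) * Polynomial.X * Polynomial.C (PowerSeries.X ^ 1) ^ i)) =
      ∑ k ∈ Finset.range (d + d + 1), Polynomial.C (qBinomial (PowerSeries.X ^ 3) (d + d) k *
        (PowerSeries.X ^ 3) ^ k.choose 2) * Polynomial.X ^ (3 * k) := by
    have h3 := qBinomial_theorem (Polynomial.C ((PowerSeries.X : ℂ⟦X⟧) ^ 3)) 1
      (Polynomial.X ^ 3) (d + d)
    rw [← Finset.prod_mul_distrib, ← Finset.prod_mul_distrib]
    refine Eq.trans (Finset.prod_congr rfl fun i _ => ?_) (h3.trans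
      (Finset.sum_congr rfl fun k _ => ?_))
    -- The factorwise identity is (1 + zy)(1 + εzy)(1 + ε²zy) = 1 + z³y³.
    · have hP : Polynomial.C (PowerSeries.C ε) ^ 2 + Polynomial.C (PowerSeries.C ε) + 1 = 0 := by
        rw [← map_pow, ← map_pow, ← map_add, ← map_add, ← map_one Polynomial.C,
          ← map_one PowerSeries.C, ← map_add, ← map_add, hε, map_zero, map_zero]
      simp only [map_pow, map_one, pow_zero, mul_zero, pow_one, mul_one, one_mul]
      generalize Polynomial.C (PowerSeries.C ε) = e at hP
      generalize (Polynomial.C (PowerSeries.X : ℂ⟦X⟧)) = x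
      rw [← pow_mul, mul_comm 3 i, pow_mul]
      generalize x ^ i = y
      linear_combination (Polynomial.X * y + e * Polynomial.X ^ 2 * y ^ 2 +
        (e - 1) * Polynomial.X ^ 3 * y ^ 3) * hP
    · rw [← map_qBinomial]
      simp only [map_mul, map_pow, one_pow, mul_one, ← pow_mul]
  rw [hprod, Polynomial.finsetSum_coeff,
    Finset.sum_eq_single_of_mem d (by rw [Finset.mem_range]; omega)
      (fun k _ hk => by rw [Polynomial.coeff_C_mul_X_pow, if_neg (by omega)]),
    Polynomial.coeff_C_mul_X_pow, if_pos rfl, mul_comm, ← pow_mul,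
    show 3 * 1 * d.choose 2 + 3 * 0 * d = 3 * d.choose 2 by ring] at h2
  have h3 := mul_left_cancel₀ (pow_ne_zero _ PowerSeries.X_ne_zero) h2
  have h4 := X_pow_dvd_eulerProduct_mul_qBinomial_sub (c := 3) (i := d) (l := d) (d := d)
    (by norm_num) (by omega) (by omega)
  rw [h3] at h4
  have h5 := (h1.mul_right (eulerProduct 3)).add (h4.mul_left (eulerProduct 1 ^ 3))
  convert h5 using 1
  ring

/-! ### Norms over the cube roots of unity -/

theorem rescale_dilate (ε : ℂ) (k : ℕ) [NeZero k] (f : ℂ⟦X⟧) :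
    PowerSeries.rescale ε (dilate k f) = dilate k (PowerSeries.rescale (ε ^ k) f) := by
  ext n
  rw [PowerSeries.coeff_rescale, dilate, PowerSeries.coeff_expand, PowerSeries.coeff_expand]
  split_ifs with h
  · obtain ⟨m, rfl⟩ := h
    rw [PowerSeries.coeff_rescale, Nat.mul_div_cancel_left _ (Nat.pos_of_ne_zero (NeZero.ne k)),
      pow_mul]
  · rw [mul_zero]

/-- The product of `f(q)`, `f(ε q)` and `f(ε² q)`. -/
noncomputable def cubicNorm (ε : ℂ) (f : ℂ⟦X⟧) : ℂ⟦X⟧ :=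
  f * PowerSeries.rescale ε f * PowerSeries.rescale (ε ^ 2) f

theorem cubicNorm_mul (ε : ℂ) (f g : ℂ⟦X⟧) :
    cubicNorm ε (f * g) = cubicNorm ε f * cubicNorm ε g := by
  simp only [cubicNorm, map_mul]
  ring

theorem cubicNorm_pow (ε : ℂ) (f : ℂ⟦X⟧) (n : ℕ) : cubicNorm ε (f ^ n) = cubicNorm ε f ^ n := by
  simp only [cubicNorm, map_pow]
  ring

theorem cube_eq_one_of_root {ε : ℂ} (hε : ε ^ 2 + ε + 1 = 0) : ε ^ 3 = 1 := by
  linear_combination (ε - 1) * hε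

theorem rescale_dilate_three {ε : ℂ} (hε : ε ^ 2 + ε + 1 = 0) (f : ℂ⟦X⟧) :
    PowerSeries.rescale ε (dilate 3 f) = dilate 3 f := by
  rw [rescale_dilate, cube_eq_one_of_root hε, PowerSeries.rescale_one, RingHom.id_apply]

theorem root_sq {ε : ℂ} (hε : ε ^ 2 + ε + 1 = 0) : (ε ^ 2) ^ 2 + ε ^ 2 + 1 = 0 := by
  linear_combination (ε ^ 2 - ε + 1) * hε

theorem cubicNorm_dilate_three {ε : ℂ} (hε : ε ^ 2 + ε + 1 = 0) (f : ℂ⟦X⟧) :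
    cubicNorm ε (dilate 3 f) = dilate 3 f ^ 3 := by
  rw [cubicNorm, rescale_dilate_three hε, rescale_dilate_three (root_sq hε)]
  ring

theorem cubicNorm_dilate_two {ε : ℂ} (hε : ε ^ 2 + ε + 1 = 0) (f : ℂ⟦X⟧) :
    cubicNorm ε (dilate 2 f) = dilate 2 (cubicNorm ε f) := by
  have h : (ε ^ 2) ^ 2 = ε := by linear_combination ε * cube_eq_one_of_root hε
  rw [cubicNorm, rescale_dilate, rescale_dilate, h, cubicNorm, map_mul, map_mul]
  ring

/-- Series in q³ are fixed by q ↦ εq, so this is the factorization of F³ + (qG)³ into F + qG, F +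
εqG, F + ε²qG. -/
theorem cubicNorm_add {ε : ℂ} (hε : ε ^ 2 + ε + 1 = 0) (f g : ℂ⟦X⟧) :
    cubicNorm ε (dilate 3 f + PowerSeries.X * dilate 3 g) =
      dilate 3 f ^ 3 + PowerSeries.X ^ 3 * dilate 3 g ^ 3 := by
  have hC : PowerSeries.C ε ^ 2 + PowerSeries.C ε + 1 = 0 := by
    rw [← map_pow, ← map_one PowerSeries.C, ← map_add, ← map_add, hε, map_zero]
  simp only [cubicNorm, map_add, map_mul, PowerSeries.rescale_X, rescale_dilate_three hε,
    rescale_dilate_three (root_sq hε), map_pow]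
  generalize PowerSeries.C ε = e at hC
  generalize dilate 3 f = F
  generalize dilate 3 g = G
  linear_combination (F ^ 2 * PowerSeries.X * G + F * PowerSeries.X ^ 2 * G ^ 2 * e +
    PowerSeries.X ^ 3 * G ^ 3 * (e - 1)) * hC

/-- The norm of 1 - q^m is 1 - q^(3m) if 3 does not divide m, and (1 - q^m)³ if it does. -/
theorem cubicNorm_eulerProduct_one {ε : ℂ} (hε : ε ^ 2 + ε + 1 = 0) :
    cubicNorm ε (eulerProduct 1) * eulerProduct 9 = eulerProduct 3 ^ 4 := by
  have hε3 := cube_eq_one_of_root hε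
  have hC : PowerSeries.C ε ^ 2 + PowerSeries.C ε + 1 = 0 := by
    rw [← map_pow, ← map_one PowerSeries.C, ← map_add, ← map_add, hε, map_zero]
  have hC3 : (PowerSeries.C ε) ^ 3 = 1 := by rw [← map_pow, hε3, map_one]
  have hfin : ∀ n : ℕ, cubicNorm ε (qPochhammer (PowerSeries.X ^ 1) (3 * n)) *
      qPochhammer (PowerSeries.X ^ 9) n =
      qPochhammer (PowerSeries.X ^ 3) (3 * n) * qPochhammer (PowerSeries.X ^ 3) n ^ 3 := by
    intro n
    induction n with
    | zero => simp [qPochhammer, cubicNorm]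
    | succ n ih =>
      have hfac : ∀ m : ℕ, cubicNorm ε (1 - (PowerSeries.X ^ 1) ^ m) =
          (1 - PowerSeries.X ^ m) * (1 - PowerSeries.C ε ^ m * PowerSeries.X ^ m) *
            (1 - PowerSeries.C ε ^ (2 * m) * PowerSeries.X ^ m) := fun m => by
        simp only [cubicNorm, map_sub, map_one, map_pow, PowerSeries.rescale_X, pow_one]
        ring
      rw [show 3 * (n + 1) = 3 * n + 1 + 1 + 1 by ring]
      simp only [qPochhammer_succ, cubicNorm_mul, hfac]
      have e1 : PowerSeries.C ε ^ (3 * n + 1) = PowerSeries.C ε := by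
        rw [pow_succ, pow_mul, hC3, one_pow, one_mul]
      have e2 : PowerSeries.C ε ^ (3 * n + 1 + 1) = PowerSeries.C ε ^ 2 := by
        rw [pow_succ, e1, sq]
      have e3 : PowerSeries.C ε ^ (3 * n + 1 + 1 + 1) = 1 := by
        rw [pow_succ, e2, ← pow_succ, hC3]
      simp only [mul_comm 2, pow_mul (PowerSeries.C ε), e1, e2, e3] at ih ⊢
      rw [show ((PowerSeries.X : ℂ⟦X⟧) ^ 9) ^ (n + 1) = (PowerSeries.X ^ (3 * n + 1 + 1 + 1)) ^ 3 by
        ring, show ((PowerSeries.X : ℂ⟦X⟧) ^ 3) ^ (n + 1) = PowerSeries.X ^ (3 * n + 1 + 1 + 1) by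
        ring, ← pow_mul _ 3 (3 * n + 1), ← pow_mul _ 3 (3 * n + 1 + 1),
        ← pow_mul _ 3 (3 * n + 1 + 1 + 1), mul_comm 3 (3 * n + 1), mul_comm 3 (3 * n + 1 + 1),
        mul_comm 3 (3 * n + 1 + 1 + 1), pow_mul _ (3 * n + 1), pow_mul _ (3 * n + 1 + 1),
        pow_mul _ (3 * n + 1 + 1 + 1)]
      generalize (PowerSeries.X : ℂ⟦X⟧) ^ (3 * n + 1) = A
      generalize (PowerSeries.X : ℂ⟦X⟧) ^ (3 * n + 1 + 1) = B
      generalize (PowerSeries.X : ℂ⟦X⟧) ^ (3 * n + 1 + 1 + 1) = D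
      have f1 : ∀ A : ℂ⟦X⟧, (1 - A) * (1 - PowerSeries.C ε * A) *
          (1 - PowerSeries.C ε ^ 2 * A) = 1 - A ^ 3 := fun A => by
        generalize PowerSeries.C ε = e at hC
        linear_combination (-A + e * A ^ 2 - (e - 1) * A ^ 3) * hC
      have f2 : ∀ A : ℂ⟦X⟧, (1 - A) * (1 - PowerSeries.C ε ^ 2 * A) *
          (1 - (PowerSeries.C ε ^ 2) ^ 2 * A) = 1 - A ^ 3 := fun A => by
        rw [show (PowerSeries.C ε ^ 2) ^ 2 = PowerSeries.C ε by
          linear_combination PowerSeries.C ε * hC3, ← f1]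
        ring
      rw [f1, f2]
      linear_combination (1 - A ^ 3) * (1 - B ^ 3) * (1 - D) ^ 3 * (1 - D ^ 3) * ih
  refine powerSeries_eq_of_forall_X_pow_dvd fun d => ?_
  have hE : ∀ k, 0 < k → ∀ n, d ≤ n + 1 → _ := fun k hk n hn =>
    (pow_dvd_pow _ hn).trans (X_pow_dvd_eulerProduct_sub hk n)
  have hR : ∀ (η : ℂ) (f g : ℂ⟦X⟧), PowerSeries.X ^ d ∣ f - g →
      PowerSeries.X ^ d ∣ PowerSeries.rescale η f - PowerSeries.rescale η g := fun η f g h => by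
    have := map_dvd (PowerSeries.rescale η) h
    rw [map_pow, PowerSeries.rescale_X, mul_pow, map_sub] at this
    exact dvd_of_mul_left_dvd this
  have h1 := hE 1 (by norm_num) (3 * d) (by omega)
  have h2 := X_pow_dvd_sub_iff.mp (hR ε _ _ h1)
  have h3 := X_pow_dvd_sub_iff.mp (hR (ε ^ 2) _ _ h1)
  have h4 := X_pow_dvd_sub_iff.mp (hE 9 (by norm_num) d (by omega))
  have h5 := X_pow_dvd_sub_iff.mp (hE 3 (by norm_num) d (by omega))
  have h6 := X_pow_dvd_sub_iff.mp (hE 3 (by norm_num) (3 * d) (by omega))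
  rw [X_pow_dvd_sub_iff] at h1 ⊢
  have hf := congrArg (Ideal.Quotient.mk (Ideal.span {(PowerSeries.X : ℂ⟦X⟧) ^ d})) (hfin d)
  simp only [cubicNorm, map_mul _ _, map_pow _ _ 3] at hf
  simp only [cubicNorm, map_mul (Ideal.Quotient.mk _), map_pow (Ideal.Quotient.mk _)]
  rw [h1, h2, h3, h4, hf, ← h5, ← h6]
  ring

theorem exists_root : ∃ ε : ℂ, ε ^ 2 + ε + 1 = 0 := by
  obtain ⟨ε, h⟩ := IsAlgClosed.exists_root (Polynomial.X ^ 2 + Polynomial.X + 1 : Polynomial ℂ)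
    (by
      have : (Polynomial.X ^ 2 + Polynomial.X + 1 : Polynomial ℂ).degree = 2 := by
        compute_degree!
      rw [this]
      norm_num)
  exact ⟨ε, by simpa using h⟩

theorem eulerProduct_ne_zero {k : ℕ} (hk : 0 < k) : eulerProduct k ≠ 0 :=
  (isUnit_eulerProduct hk).ne_zero

/-- The norm of ψ is computed twice: from its 3-dissection it is A(q³)³ + q³ψ(q⁹)³, and from its
product it is ψ(q³)⁴/ψ(q⁹). Injectivity of q ↦ q³ then removes the dilation. -/
theorem psiTheta_cubic_identity :
    pentagonalTheta ^ 3 * dilate 3 psiTheta + PowerSeries.X * dilate 3 psiTheta ^ 4 =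
      psiTheta ^ 4 := by
  obtain ⟨ε, hε⟩ := exists_root
  apply dilate_injective 3
  have h1 := congrArg (cubicNorm ε) psiTheta_mul_eulerProduct
  have h2 := cubicNorm_eulerProduct_one hε
  have h3 := congrArg (dilate 2) h2
  have h4 := congrArg (dilate 3) psiTheta_mul_eulerProduct
  have h5 := congrArg (dilate 9) psiTheta_mul_eulerProduct
  have h6 : cubicNorm ε psiTheta = _ := congrArg (cubicNorm ε) psiTheta_dissection
  rw [← dilate_dilate (show 3 * 3 = 9 from rfl), cubicNorm_add hε] at h6
  rw [cubicNorm_mul, cubicNorm_pow, h6] at h1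
  rw [map_mul, ← cubicNorm_dilate_two hε, dilate_eulerProduct 2 (by norm_num) (show 2 * 1 = 2 from rfl),
    dilate_eulerProduct 2 (by norm_num) (show 2 * 9 = 18 from rfl), map_pow,
    dilate_eulerProduct 2 (by norm_num) (show 2 * 3 = 6 from rfl)] at h3
  rw [map_mul, map_pow, dilate_eulerProduct 3 (by norm_num) (show 3 * 1 = 3 from rfl),
    dilate_eulerProduct 3 (by norm_num) (show 3 * 2 = 6 from rfl)] at h4
  rw [map_mul, map_pow, dilate_eulerProduct 9 (by norm_num) (show 9 * 1 = 9 from rfl),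
    dilate_eulerProduct 9 (by norm_num) (show 9 * 2 = 18 from rfl),
    ← dilate_dilate (show 3 * 3 = 9 from rfl)] at h5
  simp only [map_add, map_mul, map_pow, dilate_X]
  have h7 : eulerProduct 3 ^ 4 * eulerProduct 9 ≠ 0 := mul_ne_zero
    (pow_ne_zero _ (eulerProduct_ne_zero (by norm_num))) (eulerProduct_ne_zero (by norm_num))
  refine mul_left_cancel₀ h7 ?_
  generalize dilate 3 (dilate 3 psiTheta) = P9 at *
  generalize dilate 3 psiTheta = P3 at *
  generalize dilate 3 pentagonalTheta = A at *
  generalize cubicNorm ε (eulerProduct 1) = N1 at *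
  generalize cubicNorm ε (eulerProduct 2) = N2 at *
  generalize eulerProduct 3 = F3 at *
  generalize eulerProduct 9 = F9 at *
  generalize eulerProduct 18 = F18 at *
  generalize eulerProduct 6 = F6 at *
  obtain ⟨T, hT⟩ : ∃ T, T = A ^ 3 + PowerSeries.X ^ 3 * P9 ^ 3 := ⟨_, rfl⟩
  rw [← hT] at h1
  rw [show A ^ 3 * P9 + PowerSeries.X ^ 3 * P9 ^ 4 = T * P9 by rw [hT]; ring]
  linear_combination -F9 * P9 * T * h2 + F9 ^ 2 * P9 * h1 + F9 * N2 ^ 2 * h5 +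
    F9 * (N2 * F18 + F6 ^ 4) * h3 - F9 * (P3 * F3 + F6 ^ 2) * ((P3 * F3) ^ 2 + F6 ^ 4) * h4

/-- The last factor is (a³ - 27q³c³)/(a - 3qc) at argument q³. Its denominator is b(q) and its
numerator is the norm of b(q); both are Euler products, and with c = f₃³/f₁ the two sides agree. -/
theorem coreTheta_cube :
    coreTheta ^ 3 = dilate 3 coreTheta * (dilate 3 eisensteinTheta ^ 2 +
      3 * PowerSeries.X * dilate 3 eisensteinTheta * dilate 3 coreTheta +
      9 * PowerSeries.X ^ 2 * dilate 3 coreTheta ^ 2) := by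
  obtain ⟨ε, hε⟩ := exists_root
  have h1 := cubicTheta_mul_eulerProduct hε
  have h2 := congrArg (cubicNorm ε) h1
  have hE := dilate_eulerProduct 3 (by norm_num) (show 3 * 1 = 3 from rfl)
  have h3 : dilate 3 eisensteinTheta - 3 * PowerSeries.X * dilate 3 coreTheta =
      dilate 3 eisensteinTheta + PowerSeries.X * dilate 3 (-3 * coreTheta) := by
    rw [map_mul, map_neg, map_ofNat]
    ring
  rw [cubicNorm_mul, cubicNorm_pow, ← hE, cubicNorm_dilate_three hε, hE, h3, cubicNorm_add hε,
    map_mul, map_neg, map_ofNat] at h2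
  have h4 := cubicNorm_eulerProduct_one hε
  have h5 := congrArg (dilate 3) coreTheta_mul_eulerProduct
  rw [map_mul, map_pow, hE, dilate_eulerProduct 3 (by norm_num) (show 3 * 3 = 9 from rfl)] at h5
  have h6 := coreTheta_mul_eulerProduct
  have hb : (dilate 3 eisensteinTheta - 3 * PowerSeries.X * dilate 3 coreTheta) *
      eulerProduct 3 ≠ 0 := by
    rw [h1]
    exact pow_ne_zero _ (eulerProduct_ne_zero (by norm_num))
  have h3' : eulerProduct 3 ^ 3 ≠ 0 := pow_ne_zero _ (eulerProduct_ne_zero (by norm_num))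
  refine mul_left_cancel₀ (mul_ne_zero hb h3') ?_
  generalize dilate 3 coreTheta = C3 at *
  generalize dilate 3 eisensteinTheta = a3 at *
  generalize cubicNorm ε (eulerProduct 1) = N1 at *
  generalize eulerProduct 1 = F1 at *
  generalize eulerProduct 3 = F3 at *
  generalize eulerProduct 9 = F9 at *
  generalize coreTheta = C1 at *
  linear_combination F3 ^ 3 * C1 ^ 3 * h1 +
    F3 ^ 3 * ((C1 * F1) ^ 2 + C1 * F1 * F3 ^ 3 + F3 ^ 6) * h6 -
    (a3 ^ 3 - 27 * PowerSeries.X ^ 3 * C3 ^ 3) * F3 ^ 3 * h5 - F9 ^ 3 * h2 -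
    ((N1 * F9) ^ 2 + N1 * F9 * F3 ^ 4 + F3 ^ 8) * h4

/-! ### Coefficients in arithmetic progressions -/

/-- The series of the coefficients of `q ^ (m n + r)`. -/
noncomputable def progression (m r : ℕ) : ℂ⟦X⟧ →ₗ[ℂ] ℂ⟦X⟧ where
  toFun f := PowerSeries.mk fun n => PowerSeries.coeff (m * n + r) f
  map_add' f g := by ext; simp
  map_smul' a f := by ext; simp

theorem coeff_progression (m r n : ℕ) (f : ℂ⟦X⟧) :
    PowerSeries.coeff n (progression m r f) = PowerSeries.coeff (m * n + r) f := by
  simp [progression]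

theorem progression_progression (m r k s : ℕ) (f : ℂ⟦X⟧) :
    progression m r (progression k s f) = progression (k * m) (k * r + s) f := by
  ext n
  simp only [coeff_progression]
  rw [show k * (m * n + r) + s = k * m * n + (k * r + s) by ring]

theorem progression_X_pow_mul_dilate {m r s : ℕ} [NeZero m] (hr : r < m) (hs : s < m) (f : ℂ⟦X⟧) :
    progression m r (PowerSeries.X ^ s * dilate m f) = if r = s then f else 0 := by
  have hm : 0 < m := Nat.pos_of_ne_zero (NeZero.ne m)
  ext n
  rw [coeff_progression, PowerSeries.coeff_X_pow_mul', dilate, PowerSeries.coeff_expand]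
  by_cases h : r = s
  · subst h
    rw [if_pos (Nat.le_add_left _ _), Nat.add_sub_cancel, if_pos (dvd_mul_right m n), if_pos rfl,
      Nat.mul_div_cancel_left _ hm]
  · rw [if_neg h]
    split_ifs with h1 h2
    · exfalso
      obtain ⟨l, hl⟩ := h2
      have h3 : m * n + r = m * l + s := by omega
      have h4 := congrArg (· % m) h3
      simp only [Nat.mul_add_mod, Nat.mod_eq_of_lt hr, Nat.mod_eq_of_lt hs] at h4
      exact h h4
    · simp
    · simp

theorem progression_three {r : ℕ} (hr : r < 3) (f g h : ℂ⟦X⟧) :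
    progression 3 r (dilate 3 f + PowerSeries.X * dilate 3 g + PowerSeries.X ^ 2 * dilate 3 h) =
      if r = 0 then f else if r = 1 then g else h := by
  have h0 := progression_X_pow_mul_dilate hr (show 0 < 3 by norm_num) f
  have h1 := progression_X_pow_mul_dilate hr (show 1 < 3 by norm_num) g
  have h2 := progression_X_pow_mul_dilate hr (show 2 < 3 by norm_num) h
  rw [pow_zero, one_mul] at h0
  rw [pow_one] at h1
  rw [map_add, map_add, h0, h1, h2]
  interval_cases r <;> simp

theorem progression_two_one (f g : ℂ⟦X⟧) :
    progression 2 1 (dilate 2 f + PowerSeries.X * dilate 2 g) = g := by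
  have h0 := progression_X_pow_mul_dilate (show 1 < 2 by norm_num) (show 0 < 2 by norm_num) f
  have h1 := progression_X_pow_mul_dilate (show 1 < 2 by norm_num) (show 1 < 2 by norm_num) g
  rw [pow_zero, one_mul] at h0
  rw [pow_one] at h1
  rw [map_add, h0, h1]
  simp

theorem ofNat_powerSeries_ne_zero (n : ℕ) [n.AtLeastTwo] :
    (OfNat.ofNat n : ℂ⟦X⟧) ≠ 0 := by
  rw [← map_ofNat PowerSeries.C, Ne, map_eq_zero]
  exact OfNat.ofNat_ne_zero n

/-! ### The identity behind both progressions -/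

theorem altSquareTheta_mul_psiTheta_sq : altSquareTheta * psiTheta ^ 2 = eulerProduct 2 ^ 3 := by
  have h1 := altSquareTheta_mul_eulerProduct
  have h2 := psiTheta_mul_eulerProduct
  refine mul_left_cancel₀ (mul_ne_zero (pow_ne_zero 2 (eulerProduct_ne_zero one_pos))
    (eulerProduct_ne_zero two_pos)) ?_
  linear_combination (psiTheta * eulerProduct 1) ^ 2 * h1 +
    eulerProduct 1 ^ 2 * (psiTheta * eulerProduct 1 + eulerProduct 2 ^ 2) * h2

/-- Two 3-dissections of f₂³ are compared: b(q²)f₆ on one side, φ(-q)ψ(q)² with both factors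
dissected on the other. The three conclusions come from the three residue classes of exponents. -/
theorem cubic_dissection :
    dilate 2 eisensteinTheta * eulerProduct 2 = dilate 3 altSquareTheta * pentagonalTheta ^ 2 -
        2 * PowerSeries.X * altOctagonalTheta * dilate 3 psiTheta ^ 2 ∧
      dilate 3 altSquareTheta * dilate 3 psiTheta = altOctagonalTheta * pentagonalTheta ∧
      dilate 2 coreTheta * eulerProduct 2 = dilate 3 altSquareTheta * dilate 3 psiTheta ^ 2 := by
  obtain ⟨ε, hε⟩ := exists_root
  have h1 := congrArg (dilate 2) (cubicTheta_mul_eulerProduct hε)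
  rw [map_mul, map_sub, map_mul, map_mul, map_ofNat, dilate_X, map_pow,
    dilate_eulerProduct 2 (by norm_num) (show 2 * 1 = 2 from rfl),
    dilate_eulerProduct 2 (by norm_num) (show 2 * 3 = 6 from rfl),
    ← dilate_eulerProduct 3 (by norm_num) (show 3 * 2 = 6 from rfl),
    dilate_dilate (show 2 * 3 = 6 from rfl), dilate_dilate (show 2 * 3 = 6 from rfl),
    ← dilate_dilate (show 3 * 2 = 6 from rfl), ← dilate_dilate (show 3 * 2 = 6 from rfl),
    ← altSquareTheta_mul_psiTheta_sq, altSquareTheta_dissection, psiTheta_dissection,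
    ← dilate_dilate (show 3 * 3 = 9 from rfl), ← dilate_dilate (show 3 * 3 = 9 from rfl)] at h1
  set Φ := dilate 3 altSquareTheta
  set s := dilate 3 psiTheta
  set A := pentagonalTheta
  set Y := altOctagonalTheta
  set a := dilate 2 eisensteinTheta
  set c := dilate 2 coreTheta
  set F := eulerProduct 2
  have hl : (dilate 3 a - 3 * PowerSeries.X ^ 2 * dilate 3 c) * dilate 3 F =
      dilate 3 (a * F) + PowerSeries.X * dilate 3 0 +
        PowerSeries.X ^ 2 * dilate 3 (-3 * (c * F)) := by
    simp only [map_mul, map_neg, map_ofNat, map_zero]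
    ring
  have hr : (dilate 3 Φ - 2 * PowerSeries.X * dilate 3 Y) *
      (dilate 3 A + PowerSeries.X * dilate 3 s) ^ 2 =
      dilate 3 (Φ * A ^ 2 - 2 * PowerSeries.X * Y * s ^ 2) +
        PowerSeries.X * dilate 3 (2 * (Φ * s * A) - 2 * (Y * A ^ 2)) +
        PowerSeries.X ^ 2 * dilate 3 (Φ * s ^ 2 - 4 * (Y * A * s)) := by
    simp only [map_mul, map_sub, map_pow, map_ofNat, dilate_X]
    ring
  rw [hl, hr] at h1
  have e0 := congrArg (progression 3 0) h1
  have e1 := congrArg (progression 3 1) h1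
  have e2 := congrArg (progression 3 2) h1
  rw [progression_three (by norm_num), progression_three (by norm_num)] at e0 e1 e2
  norm_num at e0 e1 e2
  have hA : A ≠ 0 := by
    intro h
    have := pentagonalTheta_mul_eulerProduct
    rw [show pentagonalTheta = 0 from h, zero_mul, zero_mul] at this
    exact mul_ne_zero (eulerProduct_ne_zero two_pos)
      (pow_ne_zero 2 (eulerProduct_ne_zero three_pos)) this.symm
  -- The left side has no exponents ≡ 1 mod 3, which forces 2A(Φs - YA) = 0.
  have h2 : Φ * s = Y * A := by
    refine mul_left_cancel₀ (mul_ne_zero (ofNat_powerSeries_ne_zero 2) hA) ?_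
    linear_combination -e1
  refine ⟨e0, h2, ?_⟩
  refine mul_left_cancel₀ (ofNat_powerSeries_ne_zero 3) ?_
  linear_combination -e2 - 4 * s * h2

/-- With Φ = φ(-q³) and s = ψ(q³), the dissection gives c(q²)f₂ = Φs² and turns the bracket times f₂
into Φ(A³ + qs³). Their product is Φ²sψ⁴ by the cubic identity, and Φψ = A f₂ finishes. -/
theorem core_eisenstein_identity :
    dilate 2 coreTheta * (dilate 2 eisensteinTheta * pentagonalTheta +
      3 * PowerSeries.X * dilate 2 coreTheta * dilate 3 psiTheta) =
      pentagonalTheta ^ 2 * psiTheta ^ 2 * dilate 3 psiTheta := by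
  obtain ⟨h1, h2, h3⟩ := cubic_dissection
  have h4 := psiTheta_cubic_identity
  have h5 := pentagonalTheta_mul_eulerProduct
  have h6 := psiTheta_mul_eulerProduct
  have h7 := congrArg (dilate 3) altSquareTheta_mul_eulerProduct
  rw [map_mul, map_pow, dilate_eulerProduct 3 (by norm_num) (show 3 * 1 = 3 from rfl),
    dilate_eulerProduct 3 (by norm_num) (show 3 * 2 = 6 from rfl)] at h7
  have n1 : eulerProduct 1 ≠ 0 := eulerProduct_ne_zero (by norm_num)
  have n2 : eulerProduct 2 ≠ 0 := eulerProduct_ne_zero (by norm_num)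
  have n6 : eulerProduct 6 ≠ 0 := eulerProduct_ne_zero (by norm_num)
  generalize dilate 3 altSquareTheta = Φ at *
  generalize dilate 3 psiTheta = s at *
  generalize pentagonalTheta = A at *
  generalize altOctagonalTheta = Y at *
  generalize dilate 2 eisensteinTheta = a at *
  generalize dilate 2 coreTheta = c at *
  generalize psiTheta = ψ at *
  generalize eulerProduct 1 = F1 at *
  generalize eulerProduct 2 = F2 at *
  generalize eulerProduct 3 = F3 at *
  generalize eulerProduct 6 = F6 at *
  have h8 : Φ * ψ = A * F2 := by
    refine mul_left_cancel₀ (mul_ne_zero n1 n6) ?_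
    linear_combination ψ * F1 * h7 + F3 ^ 2 * h6 - F2 * h5
  have h9 : (a * A + 3 * PowerSeries.X * c * s) * F2 = Φ * (A ^ 3 + PowerSeries.X * s ^ 3) := by
    linear_combination A * h1 + 3 * PowerSeries.X * s * h3 + 2 * PowerSeries.X * s ^ 2 * h2
  refine mul_left_cancel₀ (pow_ne_zero 2 n2) ?_
  linear_combination (a * A + 3 * PowerSeries.X * c * s) * F2 * h3 + Φ * s ^ 2 * h9 +
    Φ ^ 2 * s * h4 + s * ψ ^ 2 * (Φ * ψ + A * F2) * h8

/-! ### The two progressions evaluated -/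

theorem progression_quadTheta_cube :
    progression 6 5 (quadTheta ^ 3) =
      72 * (dilate 2 eisensteinTheta * dilate 2 coreTheta * pentagonalTheta * psiTheta) +
      216 * PowerSeries.X * dilate 2 coreTheta ^ 2 * psiTheta * dilate 3 psiTheta +
      24 * psiTheta ^ 3 * pentagonalTheta ^ 2 * dilate 3 psiTheta := by
  have h1 : quadTheta ^ 3 = dilate 2 (dilate 2 eisensteinTheta ^ 3 +
      12 * PowerSeries.X * dilate 2 eisensteinTheta * (psiTheta * dilate 3 psiTheta) ^ 2) +
      PowerSeries.X * dilate 2 (6 * dilate 2 eisensteinTheta ^ 2 * (psiTheta * dilate 3 psiTheta) +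
        8 * PowerSeries.X * (psiTheta * dilate 3 psiTheta) ^ 3) := by
    simp only [map_add, map_mul, map_pow, map_ofNat, dilate_X,
      dilate_dilate (show 2 * 2 = 4 from rfl), dilate_dilate (show 2 * 3 = 6 from rfl)]
    rw [quadTheta_dissection]
    ring
  have h2 := congrArg (dilate 2) eisensteinTheta_dissection_three
  simp only [map_add, map_mul, map_ofNat, dilate_X, dilate_dilate (show 2 * 3 = 6 from rfl)] at h2
  simp only [← dilate_dilate (show 3 * 2 = 6 from rfl)] at h2
  have h3 := psiTheta_dissection
  rw [← dilate_dilate (show 3 * 3 = 9 from rfl)] at h3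
  rw [show progression 6 5 (quadTheta ^ 3) = progression 3 2 (progression 2 1 (quadTheta ^ 3)) from
    (progression_progression 3 2 2 1 _).symm, h1, progression_two_one]
  set a := dilate 2 eisensteinTheta
  set c := dilate 2 coreTheta
  set A := pentagonalTheta
  -- ψ(q³) is already a series in q³; only a(q²) and ψ(q) have to be dissected.
  have h4 : 6 * a ^ 2 * (psiTheta * dilate 3 psiTheta) +
      8 * PowerSeries.X * (psiTheta * dilate 3 psiTheta) ^ 3 =
      dilate 3 (6 * psiTheta * (A * a ^ 2 + 12 * PowerSeries.X * a * c * dilate 3 psiTheta) +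
        24 * PowerSeries.X * psiTheta ^ 3 * A * dilate 3 psiTheta ^ 2) +
      PowerSeries.X * dilate 3 (6 * psiTheta * (dilate 3 psiTheta * a ^ 2 +
        36 * PowerSeries.X * c ^ 2 * A) + 8 * psiTheta ^ 3 * (A ^ 3 +
          PowerSeries.X * dilate 3 psiTheta ^ 3)) +
      PowerSeries.X ^ 2 * dilate 3 (72 * (a * c * A * psiTheta) +
        216 * PowerSeries.X * c ^ 2 * psiTheta * dilate 3 psiTheta +
        24 * psiTheta ^ 3 * A ^ 2 * dilate 3 psiTheta) := by
    simp only [map_add, map_mul, map_pow, map_ofNat, dilate_X]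
    generalize dilate 3 psiTheta = P at h3 ⊢
    generalize dilate 3 P = P' at h3 ⊢
    generalize dilate 3 a = a' at h2 ⊢
    generalize dilate 3 c = c' at h2 ⊢
    generalize dilate 3 A = A' at h3 ⊢
    rw [h2, h3]
    ring
  rw [h4, progression_three (by norm_num)]
  norm_num

/-- The residue mod 3 is taken first, because the cube itself has a clean 3-dissection; its class 1
is 3 a c², whose odd part follows from the 2-dissections of a and c. -/
theorem progression_coreTheta_cube :
    progression 6 4 (coreTheta ^ 3) =
      3 * (2 * (dilate 2 eisensteinTheta * dilate 2 coreTheta * pentagonalTheta * psiTheta) +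
        6 * (psiTheta * dilate 3 psiTheta) * (PowerSeries.X * dilate 2 coreTheta ^ 2 +
          pentagonalTheta ^ 2 * psiTheta ^ 2)) := by
  have h1 : coreTheta ^ 3 = dilate 3 (coreTheta * eisensteinTheta ^ 2) +
      PowerSeries.X * dilate 3 (3 * (eisensteinTheta * coreTheta ^ 2)) +
      PowerSeries.X ^ 2 * dilate 3 (9 * coreTheta ^ 3) := by
    simp only [map_mul, map_pow, map_ofNat]
    rw [coreTheta_cube]
    ring
  rw [show progression 6 4 (coreTheta ^ 3) = progression 2 1 (progression 3 1 (coreTheta ^ 3)) from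
    (progression_progression 2 1 3 1 _).symm, h1, progression_three (by norm_num)]
  have h2 : 3 * (eisensteinTheta * coreTheta ^ 2) =
      dilate 2 (3 * (dilate 2 eisensteinTheta * (pentagonalTheta * psiTheta) ^ 2 +
        PowerSeries.X * dilate 2 eisensteinTheta * dilate 2 coreTheta ^ 2 + 12 * PowerSeries.X *
          (psiTheta * dilate 3 psiTheta) * (pentagonalTheta * psiTheta) * dilate 2 coreTheta)) +
      PowerSeries.X * dilate 2 (3 * (2 * (dilate 2 eisensteinTheta * dilate 2 coreTheta *
        pentagonalTheta * psiTheta) + 6 * (psiTheta * dilate 3 psiTheta) * (PowerSeries.X *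
          dilate 2 coreTheta ^ 2 + pentagonalTheta ^ 2 * psiTheta ^ 2))) := by
    simp only [map_add, map_mul, map_pow, map_ofNat, dilate_X,
      dilate_dilate (show 2 * 2 = 4 from rfl), dilate_dilate (show 2 * 3 = 6 from rfl)]
    conv_lhs => rw [eisensteinTheta_dissection_two, coreTheta_dissection]
    ring
  norm_num
  rw [h2, progression_two_one]

theorem progression_quadTheta_eq : progression 6 5 (quadTheta ^ 3) =
    96 * (pentagonalTheta ^ 2 * psiTheta ^ 3 * dilate 3 psiTheta) := by
  rw [progression_quadTheta_cube]
  -- The first two terms are 72ψ times the left side of the identity, and 72 + 24 = 96.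
  linear_combination 72 * psiTheta * core_eisenstein_identity

theorem progression_quadTheta_eq_coreTheta :
    progression 6 5 (quadTheta ^ 3) = 4 * progression 6 4 (coreTheta ^ 3) := by
  rw [progression_quadTheta_eq, progression_coreTheta_cube]
  -- On the core side the identity contributes 6 and the remaining term 18, a total of 24 = 96/4.
  linear_combination -24 * psiTheta * core_eisenstein_identity

theorem progression_quadTheta_mul_eulerProduct :
    progression 6 5 (quadTheta ^ 3) * eulerProduct 1 ^ 5 =
      96 * (eulerProduct 2 ^ 8 * eulerProduct 3 ^ 3) := by
  rw [progression_quadTheta_eq]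
  have h1 := pentagonalTheta_mul_eulerProduct
  have h2 := psiTheta_mul_eulerProduct
  have h3 := congrArg (dilate 3) psiTheta_mul_eulerProduct
  rw [map_mul, map_pow, dilate_eulerProduct 3 (by norm_num) (show 3 * 1 = 3 from rfl),
    dilate_eulerProduct 3 (by norm_num) (show 3 * 2 = 6 from rfl)] at h3
  have n3 : eulerProduct 3 ≠ 0 := eulerProduct_ne_zero (by norm_num)
  have n6 : eulerProduct 6 ≠ 0 := eulerProduct_ne_zero (by norm_num)
  refine mul_left_cancel₀ (mul_ne_zero n3 (pow_ne_zero 2 n6)) ?_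
  generalize dilate 3 psiTheta = s at *
  generalize pentagonalTheta = A at *
  generalize psiTheta = ψ at *
  generalize eulerProduct 1 = F1 at *
  generalize eulerProduct 2 = F2 at *
  generalize eulerProduct 3 = F3 at *
  generalize eulerProduct 6 = F6 at *
  linear_combination 96 * (s * F3) * (ψ * F1) ^ 3 * (A * F1 * F6 + F2 * F3 ^ 2) * h1 +
    96 * (s * F3) * F2 ^ 2 * F3 ^ 4 * ((ψ * F1) ^ 2 + ψ * F1 * F2 ^ 2 + F2 ^ 4) * h2 +
    96 * F2 ^ 8 * F3 ^ 4 * h3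

/-! ### Partitions as row-length sequences -/

theorem rowLens_partitionDiagram {n : ℕ} (p : n.Partition) :
    (partitionDiagram p).rowLens = p.parts.sort (· ≥ ·) :=
  YoungDiagram.rowLens_ofRowLens_eq_self fun _ hx => p.parts_pos (by simpa using hx)

theorem rowLen_eq_zero {μ : YoungDiagram} {i : ℕ} (h : μ.colLen 0 ≤ i) : μ.rowLen i = 0 := by
  by_contra h1
  have := YoungDiagram.mem_iff_lt_colLen.mp
    (YoungDiagram.mem_iff_lt_rowLen.mpr (Nat.pos_of_ne_zero h1))
  omega

theorem sum_rowLen_partitionDiagram {n : ℕ} (p : n.Partition) {k : ℕ}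
    (hk : (partitionDiagram p).colLen 0 ≤ k) :
    ∑ i ∈ Finset.range k, (partitionDiagram p).rowLen i = n := by
  have h1 : ∑ i ∈ Finset.range ((partitionDiagram p).colLen 0), (partitionDiagram p).rowLen i =
      n := by
    have h2 : (partitionDiagram p).rowLens.sum = n := by
      rw [rowLens_partitionDiagram, ← Multiset.sum_coe, Multiset.sort_eq, p.parts_sum]
    rwa [YoungDiagram.rowLens] at h2
  rw [← Finset.sum_range_add_sum_Ico _ hk, h1, Finset.sum_eq_zero, add_zero]
  intro i hi
  exact rowLen_eq_zero (Finset.mem_Ico.mp hi).1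

theorem youngDiagram_ext {μ ν : YoungDiagram} (h : ∀ i, μ.rowLen i = ν.rowLen i) : μ = ν := by
  ext ⟨i, j⟩
  rw [YoungDiagram.mem_cells, YoungDiagram.mem_cells, YoungDiagram.mem_iff_lt_rowLen,
    YoungDiagram.mem_iff_lt_rowLen, h]

theorem sigma_partition_ext {S T : Σ m : ℕ, m.Partition}
    (h : ∀ i, (partitionDiagram S.2).rowLen i = (partitionDiagram T.2).rowLen i) : S = T := by
  have h1 := congrArg YoungDiagram.rowLens (youngDiagram_ext h)
  rw [rowLens_partitionDiagram, rowLens_partitionDiagram] at h1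
  have h2 := congrArg (fun l : List ℕ => (l : Multiset ℕ)) h1
  simp only [Multiset.sort_eq] at h2
  obtain ⟨m, p⟩ := S
  obtain ⟨n, q⟩ := T
  obtain rfl : m = n := by rw [← p.parts_sum, ← q.parts_sum, h2]
  obtain rfl : p = q := Nat.Partition.ext h2
  rfl

theorem exists_partition_of_antitone {r : ℕ → ℕ} (hr : Antitone r) {k : ℕ}
    (hk : ∀ i, k ≤ i → r i = 0) :
    ∃ T : Σ m : ℕ, m.Partition, ∀ i, (partitionDiagram T.2).rowLen i = r i := by
  have hs : ((List.range k).map r).SortedGE := by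
    have h : ((List.range k).map r).Pairwise (· ≥ ·) := by
      rw [List.pairwise_map]
      exact List.pairwise_lt_range.imp fun {a b} h => hr (le_of_lt h)
    exact h.sortedGE
  let μ := YoungDiagram.ofRowLens ((List.range k).map r) hs
  have hμ : ∀ i, μ.rowLen i = r i := fun i => by
    refine eq_of_forall_lt_iff fun j => ?_
    rw [← YoungDiagram.mem_iff_lt_rowLen, YoungDiagram.mem_ofRowLens]
    constructor
    · rintro ⟨h, h1⟩
      simpa using h1
    · intro h
      have hi : i < k := by
        by_contra h1
        rw [hk i (not_lt.mp h1)] at h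
        omega
      exact ⟨by simpa using hi, by simpa using h⟩
  refine ⟨⟨_, ⟨(μ.rowLens : Multiset ℕ), fun h => μ.pos_of_mem_rowLens _ (by simpa using h), rfl⟩⟩,
    fun i => ?_⟩
  rw [← hμ]
  congr 1
  have h1 : (μ.rowLens : Multiset ℕ).sort (· ≥ ·) = μ.rowLens := by
    rw [Multiset.coe_sort]
    exact List.mergeSort_eq_self _ (by simpa using μ.rowLens_sorted.pairwise)
  simp only [partitionDiagram, h1]
  exact YoungDiagram.ofRowLens_to_rowLens_eq_self

/-! ### Beta numbers and hooks -/

/-- The beta number of the `i`-th row of a Young diagram. -/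
def betaNumber (μ : YoungDiagram) (i : ℕ) : ℤ := μ.rowLen i - i - 1

/-- The beta number of the `j`-th column of a Young diagram. -/
def colBetaNumber (μ : YoungDiagram) (j : ℕ) : ℤ := j - μ.colLen j

theorem mem_iff_colBetaNumber_lt {μ : YoungDiagram} {i j : ℕ} :
    (i, j) ∈ μ ↔ colBetaNumber μ j < betaNumber μ i := by
  have h1 : (i, j) ∈ μ ↔ j < μ.rowLen i := YoungDiagram.mem_iff_lt_rowLen
  have h2 : (i, j) ∈ μ ↔ i < μ.colLen j := YoungDiagram.mem_iff_lt_colLen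
  rw [betaNumber, colBetaNumber]
  by_cases h : (i, j) ∈ μ
  · have := h1.mp h
    have := h2.mp h
    simp only [h, true_iff]
    omega
  · have := mt h1.mpr h
    have := mt h2.mpr h
    simp only [h, false_iff]
    omega

theorem betaNumber_ne_colBetaNumber (μ : YoungDiagram) (i j : ℕ) :
    betaNumber μ i ≠ colBetaNumber μ j := by
  have h1 : (i, j) ∈ μ ↔ j < μ.rowLen i := YoungDiagram.mem_iff_lt_rowLen
  have h2 : (i, j) ∈ μ ↔ i < μ.colLen j := YoungDiagram.mem_iff_lt_colLen
  rw [betaNumber, colBetaNumber]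
  by_cases h : (i, j) ∈ μ
  · have := h1.mp h
    have := h2.mp h
    omega
  · have := mt h1.mpr h
    have := mt h2.mpr h
    omega

theorem hookNumber_eq {μ : YoungDiagram} {i j : ℕ} (h : (i, j) ∈ μ) :
    (hookNumber μ i j : ℤ) = betaNumber μ i - colBetaNumber μ j := by
  have h1 : j < μ.rowLen i := YoungDiagram.mem_iff_lt_rowLen.mp h
  have h2 : i < μ.colLen j := YoungDiagram.mem_iff_lt_colLen.mp h
  rw [betaNumber, colBetaNumber, hookNumber]
  omega

theorem betaNumber_strictAnti (μ : YoungDiagram) : StrictAnti (betaNumber μ) := by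
  intro i j h
  have := μ.rowLen_anti i j h.le
  simp only [betaNumber]
  omega

/-- The beta numbers label the steps of the boundary path of the diagram, vertical steps by rows and
horizontal ones by columns, so every integer occurs. -/
theorem exists_betaNumber_or_colBetaNumber (μ : YoungDiagram) (b : ℤ) :
    (∃ i, betaNumber μ i = b) ∨ ∃ j, colBetaNumber μ j = b := by
  classical
  have hex : ∃ i, betaNumber μ i ≤ b := by
    refine ⟨μ.rowLen 0 + b.natAbs, ?_⟩
    have := μ.rowLen_anti 0 (μ.rowLen 0 + b.natAbs) (Nat.zero_le _)
    simp only [betaNumber]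
    omega
  let i := Nat.find hex
  have hi : betaNumber μ i ≤ b := Nat.find_spec hex
  rcases hi.eq_or_lt with h | h
  · exact Or.inl ⟨i, h⟩
  right
  rw [betaNumber] at h
  refine ⟨(b + i).toNat, ?_⟩
  -- Here b lies strictly between the beta numbers of rows i and i - 1 (only the first bound if i =
  -- 0), so column b + i meets exactly the first i rows.
  have hcol : μ.colLen (b + i).toNat = i := by
    refine eq_of_forall_lt_iff fun k => ?_
    rw [← YoungDiagram.mem_iff_lt_colLen, YoungDiagram.mem_iff_lt_rowLen]
    constructor
    · intro hk
      by_contra hki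
      have := μ.rowLen_anti i k (not_lt.mp hki)
      omega
    · intro hk
      have h1 := Nat.find_min hex (show i - 1 < i by omega)
      have h2 := μ.rowLen_anti k (i - 1) (by omega)
      rw [betaNumber] at h1
      omega
  rw [colBetaNumber, hcol]
  omega

/-- A hook number is a row beta number minus a column beta number. If β - 3 is not a row label it is
a column label and yields a hook of length 3; conversely closure under subtracting 3 excludes every
column label β - 3k. -/
theorem isPartitionCore_iff {n : ℕ} (p : n.Partition) :
    IsPartitionCore 3 p ↔ ∀ i, ∃ k, betaNumber (partitionDiagram p) k =
      betaNumber (partitionDiagram p) i - 3 := by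
  set μ := partitionDiagram p with hμ
  constructor
  · intro h i
    rcases exists_betaNumber_or_colBetaNumber μ (betaNumber μ i - 3) with h1 | ⟨j, h1⟩
    · exact h1
    · exfalso
      have h2 : (i, j) ∈ μ := mem_iff_colBetaNumber_lt.mpr (by omega)
      refine h i j h2 ?_
      have h3 := hookNumber_eq h2
      rw [← hμ]
      omega
  · intro h i j hij hdvd
    rw [← hμ] at hij hdvd
    obtain ⟨k, hk⟩ := hdvd
    have h1 := hookNumber_eq hij
    have h2 : ∀ l : ℕ, ∃ m, betaNumber μ m = betaNumber μ i - 3 * l := fun l => by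
      induction l with
      | zero => exact ⟨i, by simp⟩
      | succ l ih =>
        obtain ⟨m, hm⟩ := ih
        obtain ⟨m', hm'⟩ := h m
        exact ⟨m', by rw [hm', hm]; push_cast; ring⟩
    obtain ⟨m, hm⟩ := h2 k
    refine betaNumber_ne_colBetaNumber μ m j ?_
    omega

/-! ### Three-cores as levels in the residue classes mod 3 -/

/-- The integers that lie below the given levels in the three residue classes modulo 3. -/
def BelowLevels (a b c x : ℤ) : Prop :=
  x / 3 < if x % 3 = 0 then a else if x % 3 = 1 then b else c

/-- The members of `BelowLevels a b c` that are at least `-3 l`. -/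
def levelFinset (l : ℕ) (a b c : ℤ) : Finset ℤ :=
  (Finset.range (a + l).toNat).image (fun u : ℕ => 3 * ((u : ℤ) - l)) ∪
    ((Finset.range (b + l).toNat).image (fun u : ℕ => 3 * ((u : ℤ) - l) + 1) ∪
      (Finset.range (c + l).toNat).image (fun u : ℕ => 3 * ((u : ℤ) - l) + 2))

theorem mem_levelFinset {l : ℕ} {a b c x : ℤ} :
    x ∈ levelFinset l a b c ↔ -3 * l ≤ x ∧ BelowLevels a b c x := by
  simp only [levelFinset, Finset.mem_union, Finset.mem_image, Finset.mem_range, BelowLevels]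
  constructor
  · rintro (⟨u, h1, rfl⟩ | ⟨u, h1, rfl⟩ | ⟨u, h1, rfl⟩)
    · refine ⟨by omega, ?_⟩
      rw [if_pos (by omega)]
      omega
    · refine ⟨by omega, ?_⟩
      rw [if_neg (by omega), if_pos (by omega)]
      omega
    · refine ⟨by omega, ?_⟩
      rw [if_neg (by omega), if_neg (by omega)]
      omega
  · rintro ⟨h1, h2⟩
    split_ifs at h2 with h3 h4
    · exact Or.inl ⟨(x / 3 + l).toNat, by omega, by omega⟩
    · exact Or.inr (Or.inl ⟨(x / 3 + l).toNat, by omega, by omega⟩)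
    · exact Or.inr (Or.inr ⟨(x / 3 + l).toNat, by omega, by omega⟩)

theorem sum_levelFinset (f : ℤ → ℤ) (l : ℕ) (a b c : ℤ) :
    ∑ x ∈ levelFinset l a b c, f x =
      ∑ u ∈ Finset.range (a + l).toNat, f (3 * ((u : ℤ) - l)) +
        (∑ u ∈ Finset.range (b + l).toNat, f (3 * ((u : ℤ) - l) + 1) +
          ∑ u ∈ Finset.range (c + l).toNat, f (3 * ((u : ℤ) - l) + 2)) := by
  rw [levelFinset, Finset.sum_union, Finset.sum_union, Finset.sum_image, Finset.sum_image,
    Finset.sum_image]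
  · intro x _ y _ h
    simpa using h
  · intro x _ y _ h
    simpa using h
  · intro x _ y _ h
    simpa using h
  · rw [Finset.disjoint_left]
    simp only [Finset.mem_image, not_exists, not_and]
    rintro _ ⟨u, -, rfl⟩ v - h
    omega
  · rw [Finset.disjoint_left]
    simp only [Finset.mem_union, Finset.mem_image]
    rintro _ ⟨u, -, rfl⟩ (⟨v, -, h⟩ | ⟨v, -, h⟩) <;> omega

theorem card_levelFinset {l : ℕ} {a b c : ℤ} (ha : -l ≤ a) (hb : -l ≤ b) (hc : -l ≤ c) :
    ((levelFinset l a b c).card : ℤ) = a + b + c + 3 * l := by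
  have := sum_levelFinset (fun _ => 1) l a b c
  simp only [Finset.sum_const, Finset.card_range, nsmul_eq_mul, mul_one] at this
  omega

theorem two_mul_sum_levelFinset {l : ℕ} {a b c : ℤ} (ha : -l ≤ a) (hb : -l ≤ b) (hc : -l ≤ c) :
    2 * ∑ x ∈ levelFinset l a b c, x = 3 * (a * (a - 1) + b * (b - 1) + c * (c - 1)) -
      9 * (l * (l + 1)) + 2 * (b + l) + 4 * (c + l) := by
  have key : ∀ (s : ℤ) (n : ℕ), 2 * ∑ u ∈ Finset.range n, (3 * ((u : ℤ) - l) + s) =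
      3 * (n * (n - 1)) - 6 * l * n + 2 * s * n := fun s n => by
    induction n with
    | zero => simp
    | succ n ih =>
      rw [Finset.sum_range_succ, mul_add, ih]
      push_cast
      ring
  have h0 := key 0 (a + l).toNat
  have h1 := key 1 (b + l).toNat
  have h2 := key 2 (c + l).toNat
  rw [Int.toNat_of_nonneg (by omega)] at h0 h1 h2
  simp only [add_zero] at h0
  rw [sum_levelFinset, mul_add, mul_add, h0, h1, h2]
  ring

/-- Cut off at -3l with l large, the beta set consists of the labels of the first 3l rows. Its
cardinality gives a + b + c = 0, and its sum gives the size. -/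
theorem levels_of_betaNumbers {n : ℕ} (p : n.Partition) {a b c : ℤ}
    (h : ∀ x, (∃ i, betaNumber (partitionDiagram p) i = x) ↔ BelowLevels a b c x) :
    a + b + c = 0 ∧ 2 * (n : ℤ) = 3 * (a ^ 2 + b ^ 2 + c ^ 2) + 2 * b + 4 * c := by
  set μ := partitionDiagram p with hμ
  obtain ⟨l, hl⟩ : ∃ l : ℕ, μ.colLen 0 ≤ l ∧ -l ≤ a ∧ -l ≤ b ∧ -l ≤ c :=
    ⟨μ.colLen 0 + a.natAbs + b.natAbs + c.natAbs, by omega, by omega, by omega, by omega⟩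
  have hset : levelFinset l a b c = (Finset.range (3 * l)).image (betaNumber μ) := by
    ext x
    rw [mem_levelFinset, ← h, Finset.mem_image]
    constructor
    · rintro ⟨h1, i, rfl⟩
      refine ⟨i, ?_, rfl⟩
      rw [Finset.mem_range]
      by_contra h2
      have h3 := rowLen_eq_zero (μ := μ) (i := i) (by omega)
      rw [betaNumber, h3] at h1
      omega
    · rintro ⟨i, h1, rfl⟩
      rw [Finset.mem_range] at h1
      refine ⟨?_, i, rfl⟩
      rw [betaNumber]
      omega
  have hcard := card_levelFinset hl.2.1 hl.2.2.1 hl.2.2.2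
  rw [hset, Finset.card_image_of_injective _ (betaNumber_strictAnti μ).injective,
    Finset.card_range] at hcard
  have hsum := two_mul_sum_levelFinset hl.2.1 hl.2.2.1 hl.2.2.2
  rw [hset, Finset.sum_image fun _ _ _ _ h => (betaNumber_strictAnti μ).injective h] at hsum
  have h1 := sum_rowLen_partitionDiagram p (k := 3 * l) (by rw [← hμ]; omega)
  have h2 : ∀ k : ℕ, 2 * ∑ i ∈ Finset.range k, betaNumber μ i =
      2 * ((∑ i ∈ Finset.range k, μ.rowLen i : ℕ) : ℤ) - k * (k + 1) := fun k => by
    induction k with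
    | zero => simp
    | succ k ih =>
      rw [Finset.sum_range_succ, Finset.sum_range_succ, mul_add, ih, betaNumber]
      push_cast
      ring
  rw [h2, h1] at hsum
  push_cast at hcard hsum
  have h3 : a + b + c = 0 := by linarith
  exact ⟨h3, by linear_combination hsum - 3 * h3⟩

/-- In each residue class the beta numbers are bounded above and closed under subtracting 3, and
they are nonempty because rows below the diagram are empty; hence they form a half-line. -/
theorem exists_levels {n : ℕ} {p : n.Partition} (hp : IsPartitionCore 3 p) : ∃ a b c : ℤ,
    ∀ x, (∃ i, betaNumber (partitionDiagram p) i = x) ↔ BelowLevels a b c x := by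
  rw [isPartitionCore_iff] at hp
  set μ := partitionDiagram p
  have key : ∀ s : ℤ, ∃ a : ℤ, ∀ k : ℤ, (∃ i, betaNumber μ i = 3 * k + s) ↔ k < a := fun s => by
    obtain ⟨a, ha, hmax⟩ := Int.exists_greatest_of_bdd
      (P := fun k => ∃ i, betaNumber μ i = 3 * k + s)
      ⟨μ.rowLen 0 + |s|, by
        rintro k ⟨i, hi⟩
        have := μ.rowLen_anti 0 i (Nat.zero_le _)
        rw [betaNumber] at hi
        rcases abs_cases s with h | h <;> omega⟩
      ⟨-(μ.colLen 0 + |s| + 1), (3 * (μ.colLen 0 + |s| + 1) - s - 1).toNat, by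
        have h1 := rowLen_eq_zero (μ := μ) (i := (3 * (μ.colLen 0 + |s| + 1) - s - 1).toNat)
          (by rcases abs_cases s with h | h <;> omega)
        rw [betaNumber, h1]
        rcases abs_cases s with h | h <;> omega⟩
    refine ⟨a + 1, fun k => ⟨fun hk => Int.lt_add_one_iff.mpr (hmax k hk), fun hk => ?_⟩⟩
    have h2 : ∀ l : ℕ, ∃ m, betaNumber μ m = 3 * (a - l) + s := fun l => by
      induction l with
      | zero => simpa using ha
      | succ l ih =>
        obtain ⟨m, hm⟩ := ih
        obtain ⟨m', hm'⟩ := hp m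
        exact ⟨m', by rw [hm', hm]; push_cast; ring⟩
    obtain ⟨m, hm⟩ := h2 (a - k).toNat
    exact ⟨m, by omega⟩
  obtain ⟨a, ha⟩ := key 0
  obtain ⟨b, hb⟩ := key 1
  obtain ⟨c, hc⟩ := key 2
  refine ⟨a, b, c, fun x => ?_⟩
  rw [BelowLevels]
  split_ifs with h1 h2
  · rw [← ha, show 3 * (x / 3) + 0 = x by omega]
  · rw [← hb, show 3 * (x / 3) + 1 = x by omega]
  · rw [← hc, show 3 * (x / 3) + 2 = x by omega]

theorem belowLevels_injective {a b c a' b' c' : ℤ}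
    (h : ∀ x, BelowLevels a b c x ↔ BelowLevels a' b' c' x) : b = b' ∧ c = c' := by
  constructor
  · refine eq_of_forall_lt_iff fun k => ?_
    have := h (3 * k + 1)
    rw [BelowLevels, BelowLevels, if_neg (by omega), if_pos (by omega), if_neg (by omega),
      if_pos (by omega)] at this
    rwa [show (3 * k + 1) / 3 = k by omega] at this
  · refine eq_of_forall_lt_iff fun k => ?_
    have := h (3 * k + 2)
    rw [BelowLevels, BelowLevels, if_neg (by omega), if_neg (by omega), if_neg (by omega),
      if_neg (by omega)] at this
    rwa [show (3 * k + 2) / 3 = k by omega] at this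

/-- Because a + b + c = 0, exactly 3l allowed integers are at least -3l. Listed decreasingly as x₀ >
x₁ > ..., they give row lengths xᵢ + i + 1; empty rows supply everything below -3l. -/
theorem exists_partition_of_levels {a b c : ℤ} (h : a + b + c = 0) :
    ∃ T : Σ m : ℕ, m.Partition,
      ∀ x, (∃ i, betaNumber (partitionDiagram T.2) i = x) ↔ BelowLevels a b c x := by
  obtain ⟨l, ha, hb, hc⟩ : ∃ l : ℕ, -l ≤ a ∧ -l ≤ b ∧ -l ≤ c :=
    ⟨a.natAbs + b.natAbs + c.natAbs, by omega, by omega, by omega⟩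
  have hcard : (levelFinset l a b c).card = 3 * l := by
    have := card_levelFinset ha hb hc
    omega
  let e := (levelFinset l a b c).orderEmbOfFin hcard
  have he : ∀ x, (∃ i, e i = x) ↔ x ∈ levelFinset l a b c := fun x => by
    have := Finset.range_orderEmbOfFin (levelFinset l a b c) hcard
    rw [← Finset.mem_coe, ← this]
    rfl
  have hlow : ∀ i, -3 * (l : ℤ) ≤ e i := fun i => (mem_levelFinset.mp ((he _).mp ⟨i, rfl⟩)).1
  have hstep : ∀ i j : Fin (3 * l), i ≤ j → e i + ((j : ℕ) - (i : ℕ) : ℤ) ≤ e j := fun i j hij => by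
    have key : ∀ k : ℕ, ∀ hk : (i : ℕ) + k < 3 * l, e i + k ≤ e ⟨i + k, hk⟩ := fun k => by
      induction k with
      | zero => intro hk; simp
      | succ k ih =>
        intro hk
        have h1 := ih (by omega)
        have h2 : e ⟨i + k, by omega⟩ < e ⟨i + (k + 1), hk⟩ :=
          e.strictMono (Fin.mk_lt_mk.mpr (by omega))
        push_cast
        omega
    have h1 := key (j - i) (by have := j.2; have : (i : ℕ) ≤ j := hij; omega)
    have h2 : (⟨(i : ℕ) + (j - i), by have := j.2; have : (i : ℕ) ≤ j := hij; omega⟩ :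
      Fin (3 * l)) = j := Fin.ext (by have : (i : ℕ) ≤ j := hij; simp; omega)
    rw [h2] at h1
    have : (i : ℕ) ≤ j := hij
    omega
  have hlow' : ∀ i : Fin (3 * l), -3 * (l : ℤ) + (i : ℕ) ≤ e i := fun i => by
    have h1 := hstep ⟨0, by have := i.2; omega⟩ i (Fin.mk_le_mk.mpr (Nat.zero_le _))
    have h2 := hlow ⟨0, by have := i.2; omega⟩
    dsimp only at h1
    push_cast at h1
    omega
  -- The enumeration `e` is increasing, hence the reversed index; `hlow'` shows that `toNat` loses
  -- nothing.
  let r : ℕ → ℕ := fun i => if hi : i < 3 * l then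
    (e ⟨3 * l - 1 - i, by omega⟩ + i + 1).toNat else 0
  have hr : ∀ i (hi : i < 3 * l), (r i : ℤ) = e ⟨3 * l - 1 - i, by omega⟩ + i + 1 :=
    fun i hi => by
      have := hlow' ⟨3 * l - 1 - i, by omega⟩
      simp only [r, dif_pos hi]
      dsimp only at this
      omega
  have hr0 : ∀ i, 3 * l ≤ i → r i = 0 := fun i hi => dif_neg (by omega)
  have hanti : Antitone r := by
    intro i j hij
    by_cases hj : j < 3 * l
    · have h1 := hr i (by omega)
      have h2 := hr j hj
      have h3 := hstep ⟨3 * l - 1 - j, by omega⟩ ⟨3 * l - 1 - i, by omega⟩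
        (Fin.mk_le_mk.mpr (by omega))
      dsimp only at h3
      omega
    · rw [hr0 j (by omega)]
      exact Nat.zero_le _
  obtain ⟨T, hT⟩ := exists_partition_of_antitone hanti hr0
  refine ⟨T, fun x => ?_⟩
  simp only [betaNumber, hT]
  constructor
  · rintro ⟨i, rfl⟩
    by_cases hi : i < 3 * l
    · have h1 := (mem_levelFinset.mp ((he _).mp ⟨⟨3 * l - 1 - i, by omega⟩, rfl⟩)).2
      rw [hr i hi]
      ring_nf at h1 ⊢
      exact h1
    · rw [hr0 i (by omega), BelowLevels]
      split_ifs <;> omega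
  · intro hx
    by_cases h1 : -3 * (l : ℤ) ≤ x
    · obtain ⟨⟨i, hi⟩, hix⟩ := (he x).mpr (mem_levelFinset.mpr ⟨h1, hx⟩)
      refine ⟨3 * l - 1 - i, ?_⟩
      rw [hr _ (by omega)]
      have h2 : (⟨3 * l - 1 - (3 * l - 1 - i), by omega⟩ : Fin (3 * l)) = ⟨i, hi⟩ :=
        Fin.ext (by dsimp only; omega)
      rw [h2, hix]
      ring
    · refine ⟨(-x - 1).toNat, ?_⟩
      rw [hr0 _ (by omega)]
      omega

theorem isPartitionCore_of_levels {n : ℕ} {p : n.Partition} {a b c : ℤ}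
    (h : ∀ x, (∃ i, betaNumber (partitionDiagram p) i = x) ↔ BelowLevels a b c x) :
    IsPartitionCore 3 p := by
  rw [isPartitionCore_iff]
  intro i
  rw [h]
  have := (h _).mp ⟨i, rfl⟩
  rw [BelowLevels] at this ⊢
  rw [show (betaNumber (partitionDiagram p) i - 3) % 3 = betaNumber (partitionDiagram p) i % 3 by
    omega]
  omega

theorem sigma_partition_ext_of_levels {S T : Σ m : ℕ, m.Partition} {a b c : ℤ}
    (hS : ∀ x, (∃ i, betaNumber (partitionDiagram S.2) i = x) ↔ BelowLevels a b c x)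
    (hT : ∀ x, (∃ i, betaNumber (partitionDiagram T.2) i = x) ↔ BelowLevels a b c x) : S = T := by
  refine sigma_partition_ext fun i => ?_
  have h1 : StrictMono fun i => -betaNumber (partitionDiagram S.2) i :=
    fun i j h => neg_lt_neg (betaNumber_strictAnti _ h)
  have h2 : StrictMono fun i => -betaNumber (partitionDiagram T.2) i :=
    fun i j h => neg_lt_neg (betaNumber_strictAnti _ h)
  have h3 := (StrictMono.range_inj h1 h2).mp (by
    ext x
    simp only [Set.mem_range, neg_eq_iff_eq_neg]
    rw [hS, hT])
  have h4 := congrFun h3 i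
  simp only [betaNumber] at h4
  omega

/-- The 3-cores, of any size. -/
def ThreeCore : Type := {T : Σ m : ℕ, m.Partition // IsPartitionCore 3 T.2}

theorem exists_equiv_threeCore :
    ∃ f : ℤ × ℤ ≃ ThreeCore, ∀ v, ((f v).1.1 : ℤ) = coreForm v := by
  choose F hF using fun v : ℤ × ℤ =>
    exists_partition_of_levels (show (-v.1 - v.2) + v.1 + v.2 = 0 by ring)
  let f : ℤ × ℤ → ThreeCore := fun v => ⟨F v, isPartitionCore_of_levels (hF v)⟩
  have hinj : Function.Injective f := fun v w h => by
    have h1 : F v = F w := congrArg Subtype.val h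
    have h2 := hF v
    rw [h1] at h2
    have h3 := belowLevels_injective fun x => (h2 x).symm.trans (hF w x)
    exact Prod.ext h3.1 h3.2
  have hsurj : Function.Surjective f := fun ⟨T, hT⟩ => by
    obtain ⟨a, b, c, h⟩ := exists_levels hT
    have h1 := (levels_of_betaNumbers T.2 h).1
    refine ⟨(b, c), Subtype.ext (sigma_partition_ext_of_levels (hF (b, c)) ?_)⟩
    dsimp only
    rwa [show -b - c = a by linarith]
  refine ⟨Equiv.ofBijective f ⟨hinj, hsurj⟩, fun v => ?_⟩
  have h1 := (levels_of_betaNumbers _ (hF v)).2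
  change ((F v).1 : ℤ) = _
  rw [coreForm]
  linarith

/-! ### Coefficients of the cubes and the conclusion -/

theorem coeff_thetaSeries_one_cube {S : Type*} {w : S → ℤ} (hw : Admissible w) (n : ℕ) :
    PowerSeries.coeff n (thetaSeries (fun _ => 1) w ^ 3) =
      (Nat.card {v : Fin 3 → S // ∑ i, w (v i) = n} : ℂ) := by
  rw [pow_succ, pow_two, thetaSeries_mul _ _ hw hw, thetaSeries_mul _ _ (hw.add hw) hw]
  simp only [mul_one]
  rw [coeff_thetaSeries_one ((hw.add hw).add hw)]
  congr 1
  let e : (S × S) × S ≃ (Fin 3 → S) :=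
    { toFun := fun p => ![p.1.1, p.1.2, p.2]
      invFun := fun v => ((v 0, v 1), v 2)
      left_inv := fun p => rfl
      right_inv := fun v => by
        ext i
        fin_cases i <;> rfl }
  exact Nat.card_congr (e.subtypeEquiv fun p => by rw [Fin.sum_univ_three]; rfl)

theorem card_coreTriple (n : ℕ) :
    B₃ n = Nat.card {v : Fin 3 → ℤ × ℤ // ∑ i, coreForm (v i) = n} := by
  obtain ⟨f, hf⟩ := exists_equiv_threeCore
  refine Nat.card_congr (Equiv.trans ?_ ((Equiv.piCongrRight fun _ : Fin 3 => f).subtypeEquiv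
    (q := fun T => ∑ i, (T i).1.1 = n) fun v => ?_).symm)
  · exact
      { toFun := fun T => ⟨fun i => ⟨T.1 i, T.2.2 i⟩, T.2.1⟩
        invFun := fun T => ⟨fun i => (T.1 i).1, T.2, fun i => (T.1 i).2⟩
        left_inv := fun _ => rfl
        right_inv := fun _ => rfl }
  · simp_rw [← hf]
    exact_mod_cast Iff.rfl

theorem card_senaryRep (n : ℕ) :
    ω n = Nat.card {v : Fin 3 → ℤ × ℤ // ∑ i, quadForm (v i) = n} :=
  Nat.card_congr ((Equiv.arrowProdEquivProdArrow (Fin 3) (fun _ => ℤ) fun _ => ℤ).symm.subtypeEquiv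
    fun v => by
      simp only [quadForm, Equiv.arrowProdEquivProdArrow, Equiv.coe_fn_symm_mk,
        Finset.sum_add_distrib, Finset.mul_sum])

theorem coeff_quadTheta_cube (n : ℕ) : PowerSeries.coeff n (quadTheta ^ 3) = (ω n : ℂ) := by
  rw [card_senaryRep]
  exact coeff_thetaSeries_one_cube admissible_quadForm n

theorem coeff_coreTheta_cube (n : ℕ) : PowerSeries.coeff n (coreTheta ^ 3) = (B₃ n : ℂ) := by
  rw [card_coreTriple]
  exact coeff_thetaSeries_one_cube admissible_coreForm n

theorem mainTheorem8 :
    (∀ n : ℕ, ω (6 * n + 5) = 4 * B₃ (6 * n + 4)) ∧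
    PowerSeries.mk (fun n : ℕ => (ω (6 * n + 5) : ℚ)) =
      96 * (fProd 2 ^ 8 * fProd 3 ^ 3 * (fProd 1 ^ 5)⁻¹) := by
  constructor
  · intro n
    have h := congrArg (PowerSeries.coeff n) progression_quadTheta_eq_coreTheta
    rw [show (4 : ℂ⟦X⟧) = PowerSeries.C 4 from (map_ofNat PowerSeries.C 4).symm,
      PowerSeries.coeff_C_mul, coeff_progression, coeff_progression,
      coeff_quadTheta_cube, coeff_coreTheta_cube] at h
    exact_mod_cast h
  · have hmap : PowerSeries.map (algebraMap ℚ ℂ)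
        (PowerSeries.mk fun n : ℕ => (ω (6 * n + 5) : ℚ)) = progression 6 5 (quadTheta ^ 3) := by
      ext n
      rw [PowerSeries.coeff_map, PowerSeries.coeff_mk, coeff_progression, coeff_quadTheta_cube,
        map_natCast]
    rw [← mul_assoc, PowerSeries.eq_mul_inv_iff_mul_eq (by simp [constantCoeff_fProd])]
    -- The product identity was proved over ℂ, which contains the cube root of unity; injectivity of
    -- ℚ → ℂ brings it back.
    refine PowerSeries.map_injective (algebraMap ℚ ℂ) (algebraMap ℚ ℂ).injective ?_
    simpa only [map_mul, map_pow, map_ofNat, hmap, eulerProduct] using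
      progression_quadTheta_mul_eulerProduct
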